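/- Let $(\Omega,d)$ be a separable metric space (for instance a closed invariant subset of a finite-dimensional manifold carrying a smooth flow), let $(\phi_t)_{t\in\mathbb R}$ be a continuous flow on $\Omega$, and let $\mu$ be a $\phi_t$-invariant ergodic Borel probability measure on $\Omega$. Fix $\kappa\in(0,1)$. Let $C_0^\kappa(\Omega)$ be the space of bounded $\kappa$-Hölder functions $v:\Omega\to\mathbb R$ with $\int_\Omega v\,d\mu=0$, with norm $\|v\|_{C^\kappa}=\sup_y|v(y)|+\sup_{x\ne y}|v(x)-v(y)|/d(x,y)^\kappa$, and let $C_0^\kappa(\Omega,\mathbb R^m)$ be the space of $v=(v^1,\dots,v^m)$ with all $v^i\in C^\kappa_0(\Omega)$. For $v\in C_0^\kappa(\Omega,\mathbb R^m)$, $n\ge 1$, $t\ge0$ put $$W_{v,n}(t)=n^{-1/2}\int_0^{tn}v\circ\phi_s\,ds,\qquad \mathbb W_{v,n}^{ij}(t)=n^{-1}\int_0^{tn}\!\!\int_0^s v^i\circ\phi_r\; v^j\circ\phi_s\,dr\,ds,$$ regarded as processes on the probability space $(\Omega,\mu)$. **Assumption 1.** $\mathfrak B:C_0^\kappa(\Omega)\times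 C_0^\kappa(\Omega)\to\mathbb R$ is a bilinear operator such that for every $m$ and every $v\in C^\kappa_0(\Omega,\mathbb R^m)$ there are, on some filtered probability space, a Brownian motion $W_v$ in $\mathbb R^m$ (started at $0$, with some, possibly degenerate, covariance matrix) and a process $\mathbb W_v$ with $$\mathbb W_v^{ij}(t)=\int_0^t W_v^i\,dW_v^j+\mathfrak B(v^i,v^j)\,t\qquad\text{(Itô integral)},$$ such that $(W_{v,n},\mathbb W_{v,n})\to(W_v,\mathbb W_v)$ as $n\to\infty$ in the sense of finite-dimensional distributions. **Assumption 2.** There is $p>3$ such that for all $v,w\in C_0^\kappa(\Omega)$ there is $K=K_{v,w,p}>0$ such that, for all $t\ge0$, $$\Big(\int_\Omega\Big|\int_0^t v\circ\phi_s\,ds\Big|^{2p}d\mu\Big)^{1/(2p)}\le K t^{1/2},\qquad \Big(\int_\Omega\Big|\int_0^t\!\!\int_0^s v\circ\phi_r\; w\circ\phi_s\,dr\,ds\Big|^{p}d\mu\Big)^{1/p}\le K t .$$ **Proposition.** Under Assumptions 1 and 2: (a) For all $m$, all $v\in C_0^\kappa(\Omega,\mathbb R^m)$ and all $i,j$, the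 covariance of $W_v$ is given by $\mathbf E\,W_v^i(1)W_v^j(1)=\mathfrak B(v^i,v^j)+\mathfrak B(v^j,v^i)$. (b) $\mathfrak B(v,v)\ge0$ for all $v\in C_0^\kappa(\Omega)$. (c) There is a constant $C$ such that $|\mathfrak B(v,w)|\le C\|v\|_{C^\kappa}\|w\|_{C^\kappa}$ for all $v,w\in C_0^\kappa(\Omega)$. (d) For all $m$ and all $v\in C_0^\kappa(\Omega,\mathbb R^m)$, $(W_{v,n},\mathbb W_{v,n})$ converges weakly to $(W_v,\mathbb W_v)$ as $n\to\infty$ in the supremum-norm topology, i.e. in $C([0,T],\mathbb R^m\times\mathbb R^{m\times m})$ for every $T\ge0$. Parts (a) and (d) hold for every pair $(W_v,\mathbb W_v)$ as in Assumption 1. -/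

import Mathlib

open MeasureTheory ProbabilityTheory Filter Set Topology
open scoped NNReal ENNReal

universe u w

noncomputable section

namespace FastFlow

/-! ### The fast flow and its observables -/

section Observables

variable {Ω : Type u} [MetricSpace Ω] [MeasurableSpace Ω]

/-- `μ` is an invariant ergodic measure for the flow `φ`. -/
structure IsErgodicFlow (φ : Flow ℝ Ω) (μ : Measure Ω) : Prop where
  measurePreserving : ∀ t : ℝ, MeasurePreserving (φ t) μ μ
  ergodic : ∀ s : Set Ω, MeasurableSet s → (∀ t : ℝ, φ t ⁻¹' s = s) → μ s = 0 ∨ μ sᶜ = 0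

variable [BorelSpace Ω]

/-- The space `C₀^κ(Ω)` of bounded `κ`-Hölder functions `v : Ω → ℝ` with `∫ v dμ = 0`
(for `κ > 0` the continuity clause is automatic). -/
def HolderZero (κ : ℝ≥0) (μ : Measure Ω) [IsProbabilityMeasure μ] : Submodule ℝ (Ω → ℝ) where
  carrier := {v | Continuous v ∧ (∃ C : ℝ, ∀ y, |v y| ≤ C) ∧ MemHolder κ v ∧ ∫ y, v y ∂μ = 0}
  zero_mem' := ⟨continuous_const, ⟨0, by simp⟩, memHolder_zero, by simp⟩
  add_mem' := by
    rintro v w ⟨hv, ⟨C, hC⟩, hv', hv0⟩ ⟨hw, ⟨D, hD⟩, hw', hw0⟩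
    refine ⟨hv.add hw, ⟨C + D, fun y => (abs_add_le _ _).trans (add_le_add (hC y) (hD y))⟩,
      hv'.add hw', ?_⟩
    have iv : Integrable v μ := Integrable.of_bound hv.measurable.aestronglyMeasurable C
      (Eventually.of_forall hC)
    have iw : Integrable w μ := Integrable.of_bound hw.measurable.aestronglyMeasurable D
      (Eventually.of_forall hD)
    simp [integral_add iv iw, hv0, hw0]
  smul_mem' := by
    rintro c v ⟨hv, ⟨C, hC⟩, hv', hv0⟩
    refine ⟨hv.const_smul c, ⟨|c| * C, fun y => ?_⟩, hv'.smul, ?_⟩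
    · simpa [abs_mul] using mul_le_mul_of_nonneg_left (hC y) (abs_nonneg c)
    · simp [integral_const_mul, hv0]

/-- The Hölder norm `‖v‖_{C^κ} = sup |v| + sup_{x ≠ y} |v x - v y| / d(x, y)^κ`. -/
def holderNorm {Ω : Type u} [MetricSpace Ω] (κ : ℝ≥0) (v : Ω → ℝ) : ℝ :=
  (⨆ y, |v y|) + (nnHolderNorm κ v : ℝ)

end Observables

/-! ### Birkhoff integrals and iterated integrals along the flow -/

section Integrals

variable {Ω : Type u} [TopologicalSpace Ω]

/-- `v_t = ∫₀ᵗ v ∘ φ_s ds`. -/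
def flowIntegral (φ : Flow ℝ Ω) (v : Ω → ℝ) (t : ℝ) (y : Ω) : ℝ :=
  ∫ s in (0 : ℝ)..t, v (φ s y)

/-- `S_t = ∫₀ᵗ ∫₀ˢ v ∘ φ_r w ∘ φ_s dr ds`. -/
def iteratedIntegral (φ : Flow ℝ Ω) (v w : Ω → ℝ) (t : ℝ) (y : Ω) : ℝ :=
  ∫ s in (0 : ℝ)..t, ∫ r in (0 : ℝ)..s, v (φ r y) * w (φ s y)

/-- The state space `ℝ^m × ℝ^{m × m}` of the pairs `(W, 𝕎)`. -/
abbrev PairSpace (m : ℕ) : Type := (Fin m → ℝ) × (Fin m → Fin m → ℝ)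

/-- `W_{v,n}(t) = n^{-1/2} ∫₀^{tn} v ∘ φ_s ds`. -/
def scaledW (φ : Flow ℝ Ω) {m : ℕ} (v : Fin m → Ω → ℝ) (n : ℕ) (t : ℝ≥0) (y : Ω) : Fin m → ℝ :=
  fun i => (Real.sqrt n)⁻¹ * flowIntegral φ (v i) (t * n) y

/-- `𝕎_{v,n}(t) = n^{-1} ∫₀^{tn} ∫₀ˢ v ∘ φ_r ⊗ v ∘ φ_s dr ds`. -/
def scaledWW (φ : Flow ℝ Ω) {m : ℕ} (v : Fin m → Ω → ℝ) (n : ℕ) (t : ℝ≥0) (y : Ω) :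
    Fin m → Fin m → ℝ :=
  fun i j => (n : ℝ)⁻¹ * iteratedIntegral φ (v i) (v j) (t * n) y

/-- The pair `(W_{v,n}, 𝕎_{v,n})`. -/
def scaledPair (φ : Flow ℝ Ω) {m : ℕ} (v : Fin m → Ω → ℝ) (n : ℕ) (t : ℝ≥0) (y : Ω) :
    PairSpace m :=
  (scaledW φ v n t y, scaledWW φ v n t y)

end Integrals

/-! ### Brownian motion and the Itô integral -/

section Ito

variable {Ξ : Type w} [mΞ : MeasurableSpace Ξ]

/-- `W` is an `m`-dimensional Brownian motion with respect to the filtration `𝓕`, started at `0`,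
with some (possibly degenerate) covariance matrix `S`. -/
structure IsBrownianMotion {m : ℕ} (𝓕 : Filtration ℝ≥0 mΞ) (P : Measure Ξ)
    (W : ℝ≥0 → Ξ → Fin m → ℝ) : Prop where
  adapted : ∀ t, Measurable[𝓕 t] (W t)
  start : ∀ᵐ ω ∂P, W 0 ω = 0
  indep : ∀ s t, s ≤ t →
    Indep (𝓕 s) (MeasurableSpace.comap (fun ω => W t ω - W s ω) inferInstance) P
  gaussian : ∃ S : Matrix (Fin m) (Fin m) ℝ, S.PosSemidef ∧ ∀ s t : ℝ≥0, s ≤ t →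
    HasLaw (fun ω => WithLp.toLp 2 (W t ω - W s ω))
      (multivariateGaussian 0 (((t : ℝ) - (s : ℝ)) • S)) P
  continuous : ∀ᵐ ω ∂P, Continuous fun t => W t ω

/-- A bounded simple predictable process `∑ₖ ξₖ 1_{(tₖ, tₖ₊₁]}`, with `ξₖ` bounded and
`𝓕_{tₖ}`-measurable. -/
structure SimpleProcess (𝓕 : Filtration ℝ≥0 mΞ) where
  size : ℕ
  time : Fin (size + 1) → ℝ≥0
  mono : Monotone time
  val : Fin size → Ξ → ℝ
  adapted : ∀ k, Measurable[𝓕 (time k.castSucc)] (val k)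
  bounded : ∀ k, ∃ C : ℝ, ∀ ω, |val k ω| ≤ C

/-- The value of a simple process at time `s`. -/
def SimpleProcess.eval {𝓕 : Filtration ℝ≥0 mΞ} (H : SimpleProcess 𝓕) (s : ℝ≥0) (ω : Ξ) : ℝ :=
  ∑ k, (Ioc (H.time k.castSucc) (H.time k.succ)).indicator (fun _ => H.val k ω) s

/-- The elementary stochastic integral `∫₀ᵗ H dX` of a simple process. -/
def SimpleProcess.integral {𝓕 : Filtration ℝ≥0 mΞ} (H : SimpleProcess 𝓕) (X : ℝ≥0 → Ξ → ℝ)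
    (t : ℝ≥0) (ω : Ξ) : ℝ :=
  ∑ k, H.val k ω * (X (min t (H.time k.succ)) ω - X (min t (H.time k.castSucc)) ω)

/-- `I` is the (continuous version of the) Itô integral process `t ↦ ∫₀ᵗ H dX` against the
(one-dimensional) Brownian motion `X`: for every `t`, `I t` is the `L²(P)`-limit of elementary
integrals of simple processes converging to `H` in `L²([0,t] × Ξ)`. -/
structure IsItoIntegral (𝓕 : Filtration ℝ≥0 mΞ) (P : Measure Ξ) (H X I : ℝ≥0 → Ξ → ℝ) :
    Prop where
  memLp : ∀ t, MemLp (I t) 2 P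
  approx : ∀ t : ℝ≥0, ∃ A : ℕ → SimpleProcess 𝓕,
    Tendsto (fun n => ∫⁻ ω, (∫⁻ s in Icc (0 : ℝ) t,
      ENNReal.ofReal (((A n).eval s.toNNReal ω - H s.toNNReal ω) ^ 2) ∂volume) ∂P) atTop (𝓝 0) ∧
    Tendsto (fun n => eLpNorm (fun ω => (A n).integral X t ω - I t ω) 2 P) atTop (𝓝 0)
  continuous : ∀ᵐ ω ∂P, Continuous fun t => I t ω

end Ito

/-! ### Two modes of convergence of processes -/

section Convergence

variable {Ω : Type u} [MeasurableSpace Ω] {Ξ : Type w} [MeasurableSpace Ξ]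
  {E : Type} [NormedAddCommGroup E] [MeasurableSpace E] [BorelSpace E]

/-- Convergence `X_n → Z` of processes in the sense of finite-dimensional distributions. -/
def TendstoFDD [SecondCountableTopology E] (X : ℕ → ℝ≥0 → Ω → E) (μ : Measure Ω)
    [IsProbabilityMeasure μ] (Z : ℝ≥0 → Ξ → E) (P : Measure Ξ) [IsProbabilityMeasure P] : Prop :=
  ∀ I : Finset ℝ≥0, TendstoInDistribution (fun n y => I.restrict fun t => X n t y) atTop
    (fun ω => I.restrict fun t => Z t ω) (fun _ => μ) P

/-- The Borel σ-algebra of the space `C([0,T], E)` with the supremum norm. -/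
instance instMeasurableSpacePath (T : ℝ≥0) : MeasurableSpace C(Icc (0 : ℝ≥0) T, E) := borel _

instance instBorelSpacePath (T : ℝ≥0) : BorelSpace C(Icc (0 : ℝ≥0) T, E) := ⟨rfl⟩

open Classical in
/-- The restriction to `[0,T]` of a function, as an element of `C([0,T], E)`; functions that are not
continuous on `[0,T]` are sent to `0`. -/
def toPath (T : ℝ≥0) (f : ℝ≥0 → E) : C(Icc (0 : ℝ≥0) T, E) :=
  if h : ContinuousOn f (Icc 0 T) then ⟨(Icc 0 T).domRestrict f, h.domRestrict⟩ else 0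

/-- Weak convergence `X_n →_w Z` of processes with (almost surely) continuous paths in the supremum
norm topology, on every compact time interval `[0,T]`. -/
def TendstoWeaklySup (X : ℕ → ℝ≥0 → Ω → E) (μ : Measure Ω)
    [IsProbabilityMeasure μ] (Z : ℝ≥0 → Ξ → E) (P : Measure Ξ) [IsProbabilityMeasure P] : Prop :=
  (∀ n, ∀ᵐ y ∂μ, Continuous fun t => X n t y) ∧ (∀ᵐ ω ∂P, Continuous fun t => Z t ω) ∧
  ∀ T : ℝ≥0, TendstoInDistribution (fun n y => toPath T fun t => X n t y) atTop
    (fun ω => toPath T fun t => Z t ω) (fun _ => μ) P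

end Convergence

/-! ### The two assumptions on the fast flow -/

section Assumptions

variable {Ω : Type u} [MetricSpace Ω] [MeasurableSpace Ω] [BorelSpace Ω]

/-- `(W, 𝕎)`, defined on `(Ξ, 𝓕, P)`, is a limit pair for the observable `v`: `W` is a Brownian
motion in `ℝ^m`, `𝕎^{ij}(t) = ∫₀ᵗ W^i dW^j + 𝔅(v^i, v^j) t` with an Itô integral, and
`(W_{v,n}, 𝕎_{v,n}) → (W, 𝕎)` in the sense of finite-dimensional distributions. -/
structure IsLimitPair (φ : Flow ℝ Ω) (μ : Measure Ω) [IsProbabilityMeasure μ] {κ : ℝ≥0}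
    (𝔅 : HolderZero κ μ →ₗ[ℝ] HolderZero κ μ →ₗ[ℝ] ℝ) {m : ℕ} (v : Fin m → HolderZero κ μ)
    {Ξ : Type w} [mΞ : MeasurableSpace Ξ] (𝓕 : Filtration ℝ≥0 mΞ) (P : Measure Ξ)
    [IsProbabilityMeasure P]
    (W : ℝ≥0 → Ξ → Fin m → ℝ) (WW : ℝ≥0 → Ξ → Fin m → Fin m → ℝ) : Prop where
  brownian : IsBrownianMotion 𝓕 P W
  ito : ∀ i j, IsItoIntegral 𝓕 P (fun t ω => W t ω i) (fun t ω => W t ω j)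
    (fun t ω => WW t ω i j - 𝔅 (v i) (v j) * t)
  tendsto : TendstoFDD (scaledPair φ fun i => (v i : Ω → ℝ)) μ (fun t ω => (W t ω, WW t ω)) P

/-- The iterated central limit theorem assumption, with bilinear operator `𝔅`: for all `m` and all
`v ∈ C₀^κ(Ω, ℝ^m)` there is a limit pair `(W_v, 𝕎_v)` on some probability space. -/
def IteratedCLT (φ : Flow ℝ Ω) (μ : Measure Ω) [IsProbabilityMeasure μ] {κ : ℝ≥0}
    (𝔅 : HolderZero κ μ →ₗ[ℝ] HolderZero κ μ →ₗ[ℝ] ℝ) : Prop :=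
  ∀ (m : ℕ) (v : Fin m → HolderZero κ μ),
    ∃ (Ξ : Type w) (mΞ : MeasurableSpace Ξ) (𝓕 : Filtration ℝ≥0 mΞ) (P : Measure Ξ)
      (_ : IsProbabilityMeasure P) (W : ℝ≥0 → Ξ → Fin m → ℝ)
      (WW : ℝ≥0 → Ξ → Fin m → Fin m → ℝ), IsLimitPair φ μ 𝔅 v 𝓕 P W WW

/-- The moment assumption: for some `p > 3` and all `v, w ∈ C₀^κ(Ω)` there is `K > 0` with
`(E_μ |v_t|^{2p})^{1/(2p)} ≤ K t^{1/2}` and `(E_μ |S_t|^p)^{1/p} ≤ K t` for all `t ≥ 0`. -/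
def MomentBounds (φ : Flow ℝ Ω) (κ : ℝ≥0) (μ : Measure Ω) [IsProbabilityMeasure μ] : Prop :=
  ∃ p : ℝ, 3 < p ∧ ∀ v w : HolderZero κ μ, ∃ K : ℝ, 0 < K ∧ ∀ t : ℝ, 0 ≤ t →
    (∫ y, |flowIntegral φ v t y| ^ (2 * p) ∂μ) ^ (1 / (2 * p)) ≤ K * t ^ (1 / 2 : ℝ) ∧
    (∫ y, |iteratedIntegral φ v w t y| ^ p ∂μ) ^ (1 / p) ≤ K * t

end Assumptions

end FastFlow

end

noncomputable section

namespace FastFlow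

/-! ### Pathwise calculus of Birkhoff and iterated integrals -/

section Deterministic

variable {Ω : Type u} [MetricSpace Ω] (φ : Flow ℝ Ω) {v w : Ω → ℝ}

/-! The algebra comes from two pathwise identities for the smooth paths $v_t=\int_0^t
v\circ\phi_s\,ds$: Chen's relation (`iteratedIntegral_add`) and integration by parts
(`flowIntegral_mul_flowIntegral`).

Covariance and positivity. Integration by parts is a closed polynomial relation, so it survives
convergence of one-dimensional marginals: almost surely $W^iW^j=\mathbb W^{ij}+\mathbb W^{ji}$
(`IsLimitPair.mul_eq_add`). Itô integrals against Brownian motion are centred, so $\mathbf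
E\,\mathbb W^{ij}(1)=\mathfrak B(v^i,v^j)$ (`IsLimitPair.integral_snd`). Taking expectations gives
the covariance, and the case of a single observable gives $2\mathfrak B(v,v)=\mathbf E\,W(1)^2\ge0$.

Boundedness. The moment constant depends on $v,w$ in an uncontrolled way. But $(v,w)\mapsto
n^{-1}\int_0^n\int_0^s v\circ\phi_r\,w\circ\phi_s\,dr\,ds$ is, for each $n$, a bounded bilinear map
into $L^1(\mu)$, and the moment assumption bounds this family at each pair $(v,w)$. Since
$C_0^\kappa$ is complete, Banach–Steinhaus in each variable gives one constant
(`exists_integral_abs_scaledWW_le`). Fatou along the convergence in law transfers it to $\mathbf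
E|\mathbb W^{ij}(1)|$, hence to $|\mathfrak B|$.

Weak convergence. By stationarity and Chen's relation the third moments of increments over time $h$
are $O(h^{3/2})$ uniformly in $n$ (`exists_scaledPair_increment_bound`), and $3/2>1$ allows
chaining. No tightness or compactness argument is needed: a path is compared with the interpolation
of its values on a grid of mesh $64^{-k}$, which is a continuous function of finitely many
marginals. The error is $O(2^{-k})$ in mean, uniformly in $n$ (`lintegral_edist_interpPath_le`), and
a three-epsilon argument against bounded Lipschitz functionals concludes
(`TendstoFDD.tendstoWeaklySup`). -/

lemma continuous_observable_flow (hv : Continuous v) :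
    Continuous fun p : ℝ × Ω => v (φ p.1 p.2) :=
  hv.comp (φ.continuous continuous_fst continuous_snd)

lemma continuous_flowIntegral (hv : Continuous v) :
    Continuous fun p : ℝ × Ω => flowIntegral φ v p.1 p.2 := by
  unfold flowIntegral
  exact intervalIntegral.continuous_parametric_intervalIntegral_of_continuous
    (f := fun (p : ℝ × Ω) s => v (φ s p.2))
    ((continuous_observable_flow φ hv).comp (continuous_snd.prodMk (continuous_snd.comp continuous_fst)))
    continuous_fst

lemma iteratedIntegral_eq (v w : Ω → ℝ) (t : ℝ) (y : Ω) :
    iteratedIntegral φ v w t y = ∫ s in (0 : ℝ)..t, flowIntegral φ v s y * w (φ s y) := by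
  simp only [iteratedIntegral, flowIntegral, intervalIntegral.integral_mul_const]

lemma continuous_flowIntegral_mul (hv : Continuous v) (hw : Continuous w) :
    Continuous fun p : ℝ × Ω => flowIntegral φ v p.1 p.2 * w (φ p.1 p.2) :=
  (continuous_flowIntegral φ hv).mul (continuous_observable_flow φ hw)

lemma continuous_iteratedIntegral (hv : Continuous v) (hw : Continuous w) :
    Continuous fun p : ℝ × Ω => iteratedIntegral φ v w p.1 p.2 := by
  simp only [iteratedIntegral_eq]
  exact intervalIntegral.continuous_parametric_intervalIntegral_of_continuous
    (f := fun (p : ℝ × Ω) s => flowIntegral φ v s p.2 * w (φ s p.2))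
    ((continuous_flowIntegral_mul φ hv hw).comp
      (continuous_snd.prodMk (continuous_snd.comp continuous_fst)))
    continuous_fst

lemma flowIntegral_add (hv : Continuous v) (s t : ℝ) (y : Ω) :
    flowIntegral φ v (s + t) y = flowIntegral φ v s y + flowIntegral φ v t (φ s y) := by
  have hc : Continuous fun r => v (φ r y) :=
    (continuous_observable_flow φ hv).comp (continuous_id.prodMk continuous_const)
  unfold flowIntegral
  rw [← intervalIntegral.integral_add_adjacent_intervals (b := s)
    (hc.intervalIntegrable _ _) (hc.intervalIntegrable _ _)]
  congr 1
  have := intervalIntegral.integral_comp_add_right (a := 0) (b := t) (fun r => v (φ r y)) s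
  simp only [zero_add, add_comm t s] at this
  rw [← this]
  simp only [φ.map_add]

/-- Chen's relation. After time $s$ the inner integral splits into its value at $s$, which factors
out and gives the product term, and the integral along the orbit of $\phi_s y$. -/
lemma iteratedIntegral_add (hv : Continuous v) (hw : Continuous w) (s t : ℝ) (y : Ω) :
    iteratedIntegral φ v w (s + t) y = iteratedIntegral φ v w s y +
      iteratedIntegral φ v w t (φ s y) + flowIntegral φ v s y * flowIntegral φ w t (φ s y) := by
  have hc : ∀ z, Continuous fun r => flowIntegral φ v r z * w (φ r z) := fun z =>
    (continuous_flowIntegral_mul φ hv hw).comp (continuous_id.prodMk continuous_const)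
  have hc' : Continuous fun r => w (φ r (φ s y)) :=
    (continuous_observable_flow φ hw).comp (continuous_id.prodMk continuous_const)
  simp only [iteratedIntegral_eq]
  rw [← intervalIntegral.integral_add_adjacent_intervals (b := s)
    ((hc y).intervalIntegrable _ _) ((hc y).intervalIntegrable _ _), add_assoc]
  congr 1
  have := intervalIntegral.integral_comp_add_right (a := 0) (b := t)
    (fun r => flowIntegral φ v r y * w (φ r y)) s
  simp only [zero_add, add_comm t s] at this
  rw [← this]
  simp only [add_comm _ s, flowIntegral_add φ hv]
  simp only [add_comm s _, φ.map_add, add_mul]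
  rw [intervalIntegral.integral_add ((hc'.const_mul _).intervalIntegrable _ _)
    ((hc _).intervalIntegrable _ _), intervalIntegral.integral_const_mul, add_comm]
  rfl

lemma flowIntegral_zero (v : Ω → ℝ) (y : Ω) : flowIntegral φ v 0 y = 0 := by
  simp [flowIntegral]

lemma hasDerivAt_flowIntegral (hv : Continuous v) (t : ℝ) (y : Ω) :
    HasDerivAt (fun s => flowIntegral φ v s y) (v (φ t y)) t := by
  have hc : Continuous fun r => v (φ r y) :=
    (continuous_observable_flow φ hv).comp (continuous_id.prodMk continuous_const)
  exact hc.integral_hasStrictDerivAt 0 t |>.hasDerivAt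

/-- Integration by parts for the smooth paths `t ↦ ∫₀ᵗ v ∘ φ_s ds`. -/
lemma flowIntegral_mul_flowIntegral (hv : Continuous v) (hw : Continuous w) (t : ℝ) (y : Ω) :
    flowIntegral φ v t y * flowIntegral φ w t y =
      iteratedIntegral φ v w t y + iteratedIntegral φ w v t y := by
  have hc : ∀ {v w : Ω → ℝ}, Continuous v → Continuous w →
      Continuous fun r => flowIntegral φ v r y * w (φ r y) := fun hv hw =>
    (continuous_flowIntegral_mul φ hv hw).comp (continuous_id.prodMk continuous_const)
  have hcv : ∀ {v : Ω → ℝ}, Continuous v → Continuous fun r => v (φ r y) := fun hv =>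
    (continuous_observable_flow φ hv).comp (continuous_id.prodMk continuous_const)
  have := intervalIntegral.integral_deriv_mul_eq_sub (a := 0) (b := t)
    (fun s _ => hasDerivAt_flowIntegral φ hv s y) (fun s _ => hasDerivAt_flowIntegral φ hw s y)
    ((hcv hv).intervalIntegrable _ _) ((hcv hw).intervalIntegrable _ _)
  simp only [flowIntegral_zero, mul_zero, sub_zero] at this
  rw [← this, iteratedIntegral_eq, iteratedIntegral_eq, ← intervalIntegral.integral_add
    ((hc hv hw).intervalIntegrable _ _) ((hc hw hv).intervalIntegrable _ _)]
  congr 1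
  ext s
  ring

lemma abs_flowIntegral_le {C : ℝ} (hC : ∀ y, |v y| ≤ C) (t : ℝ) (y : Ω) :
    |flowIntegral φ v t y| ≤ C * |t| := by
  have := intervalIntegral.norm_integral_le_of_norm_le_const (a := 0) (b := t)
    (f := fun s => v (φ s y)) (C := C) (fun s _ => hC _)
  simpa [flowIntegral] using this

lemma abs_iteratedIntegral_le {C D : ℝ} (hC : ∀ y, |v y| ≤ C) (hD : ∀ y, |w y| ≤ D)
    (t : ℝ) (y : Ω) : |iteratedIntegral φ v w t y| ≤ C * D * |t| ^ 2 := by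
  have hC0 : 0 ≤ C := (abs_nonneg _).trans (hC y)
  rw [iteratedIntegral_eq]
  have := intervalIntegral.norm_integral_le_of_norm_le_const (a := 0) (b := t)
    (f := fun s => flowIntegral φ v s y * w (φ s y)) (C := C * |t| * D) (fun s hs => by
      rw [Real.norm_eq_abs, abs_mul]
      have hst : |s| ≤ |t| := by
        rcases le_total 0 t with h | h
        · rw [uIoc_of_le h] at hs
          rw [abs_of_pos hs.1, abs_of_nonneg h]; exact hs.2
        · rw [uIoc_of_ge h] at hs
          rw [abs_of_nonpos hs.2, abs_of_nonpos h]; linarith [hs.1]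
      exact mul_le_mul ((abs_flowIntegral_le φ hC s y).trans
        (mul_le_mul_of_nonneg_left hst hC0)) (hD _) (abs_nonneg _) (by positivity))
  rw [Real.norm_eq_abs, sub_zero] at this
  linarith [this, (by ring : C * |t| * D * |t| = C * D * |t| ^ 2)]

end Deterministic

/-! ### Moment inequalities for bounded random variables -/

section Moments

variable {α : Type*} [MeasurableSpace α] {μ : Measure α} [IsProbabilityMeasure μ]

/-- Lower moments of a bounded random variable are controlled by higher ones. -/
lemma integral_abs_pow_le_of_rpow {X : α → ℝ} (hX : Measurable X) {C : ℝ} (hC : ∀ y, |X y| ≤ C)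
    {q M : ℝ} {r : ℕ} (hr : 0 < r) (hrq : (r : ℝ) ≤ q) (hM : (∫ y, |X y| ^ q ∂μ) ^ (1 / q) ≤ M) :
    ∫ y, |X y| ^ r ∂μ ≤ M ^ r := by
  have hr' : (0 : ℝ) < r := by exact_mod_cast hr
  have hq : 0 < q := hr'.trans_le hrq
  have hI0 : 0 ≤ ∫ y, |X y| ^ r ∂μ := integral_nonneg fun y => by positivity
  have hJ0 : 0 ≤ ∫ y, |X y| ^ q ∂μ := integral_nonneg fun y => by positivity
  have h1 : Integrable (fun y => |X y| ^ r) μ :=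
    Integrable.of_bound (by fun_prop) (C ^ r) (Eventually.of_forall fun y => by
      rw [Real.norm_eq_abs, abs_pow, abs_abs]; gcongr; exact hC y)
  have h2 : Integrable (fun y => |X y| ^ q) μ :=
    Integrable.of_bound (by fun_prop) (C ^ q) (Eventually.of_forall fun y => by
      rw [Real.norm_eq_abs, abs_of_nonneg (by positivity)]; gcongr; exact hC y)
  have hcomp : ∀ y, (|X y| ^ r) ^ (q / r) = |X y| ^ q := fun y => by
    rw [← Real.rpow_natCast, ← Real.rpow_mul (abs_nonneg _), mul_div_cancel₀ _ hr'.ne']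
  have hq1 : 1 ≤ q / r := (one_le_div hr').2 hrq
  -- Jensen's inequality for $x\mapsto x^{q/r}$ applied to $|X|^r$.
  have key := (convexOn_rpow hq1).map_integral_le (μ := μ) (f := fun y => |X y| ^ r)
    (continuousOn_id.rpow_const fun x _ => Or.inr (by positivity)) isClosed_Ici
    (Eventually.of_forall fun y => by simp only [mem_Ici]; positivity) h1
    (by simpa only [Function.comp_def, hcomp] using h2)
  simp only [hcomp] at key
  have h3 : ∫ y, |X y| ^ r ∂μ = ((∫ y, |X y| ^ r ∂μ) ^ (q / r)) ^ (r / q) := by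
    rw [← Real.rpow_mul hI0, div_mul_div_cancel₀ hr'.ne', div_self hq.ne', Real.rpow_one]
  calc ∫ y, |X y| ^ r ∂μ = ((∫ y, |X y| ^ r ∂μ) ^ (q / r)) ^ (r / q) := h3
    _ ≤ (∫ y, |X y| ^ q ∂μ) ^ (r / q) := by gcongr
    _ = ((∫ y, |X y| ^ q ∂μ) ^ (1 / q)) ^ r := by
      rw [← Real.rpow_natCast, ← Real.rpow_mul hJ0]; congr 1; ring
    _ ≤ M ^ r := by gcongr

/-- The Cauchy–Schwarz inequality for cubes of products of bounded functions. -/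
lemma integral_abs_mul_pow_three_le {X Y : α → ℝ} (hX : Measurable X) (hY : Measurable Y)
    {C D A B : ℝ} (hC : ∀ y, |X y| ≤ C) (hD : ∀ y, |Y y| ≤ D) (hA : 0 < A) (hB : 0 < B)
    (hXA : ∫ y, |X y| ^ 6 ∂μ ≤ A ^ 6) (hYB : ∫ y, |Y y| ^ 6 ∂μ ≤ B ^ 6) :
    ∫ y, |X y * Y y| ^ 3 ∂μ ≤ A ^ 3 * B ^ 3 := by
  have h1 : Integrable (fun y => |X y| ^ 6) μ :=
    Integrable.of_bound (by fun_prop) (C ^ 6) (Eventually.of_forall fun y => by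
      rw [Real.norm_eq_abs, abs_pow, abs_abs]; gcongr; exact hC y)
  have h2 : Integrable (fun y => |Y y| ^ 6) μ :=
    Integrable.of_bound (by fun_prop) (D ^ 6) (Eventually.of_forall fun y => by
      rw [Real.norm_eq_abs, abs_pow, abs_abs]; gcongr; exact hD y)
  -- Young's inequality, with weights chosen so that after integration each term is at most
  -- $A^3B^3/2$.
  have h3 : ∀ y, |X y * Y y| ^ 3 ≤
      B ^ 3 / A ^ 3 / 2 * |X y| ^ 6 + A ^ 3 / B ^ 3 / 2 * |Y y| ^ 6 := fun y => by
    rw [abs_mul, mul_pow]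
    generalize |X y| = x
    generalize |Y y| = z
    have : B ^ 3 / A ^ 3 / 2 * x ^ 6 + A ^ 3 / B ^ 3 / 2 * z ^ 6 - x ^ 3 * z ^ 3 =
      (B ^ 3 * x ^ 3 - A ^ 3 * z ^ 3) ^ 2 / (2 * A ^ 3 * B ^ 3) := by
      field_simp; ring
    have h0 : 0 ≤ (B ^ 3 * x ^ 3 - A ^ 3 * z ^ 3) ^ 2 / (2 * A ^ 3 * B ^ 3) := by positivity
    linarith
  calc ∫ y, |X y * Y y| ^ 3 ∂μ
      ≤ ∫ y, B ^ 3 / A ^ 3 / 2 * |X y| ^ 6 + A ^ 3 / B ^ 3 / 2 * |Y y| ^ 6 ∂μ :=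
        integral_mono_of_nonneg (Eventually.of_forall fun y => by positivity)
          ((h1.const_mul _).add (h2.const_mul _)) (Eventually.of_forall h3)
    _ = B ^ 3 / A ^ 3 / 2 * ∫ y, |X y| ^ 6 ∂μ + A ^ 3 / B ^ 3 / 2 * ∫ y, |Y y| ^ 6 ∂μ := by
        rw [integral_add (h1.const_mul _) (h2.const_mul _), integral_const_mul, integral_const_mul]
    _ ≤ B ^ 3 / A ^ 3 / 2 * A ^ 6 + A ^ 3 / B ^ 3 / 2 * B ^ 6 := by gcongr
    _ = A ^ 3 * B ^ 3 := by field_simp; ring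

lemma integrable_of_measurable_of_bounded {X : α → ℝ} (hX : Measurable X) {C : ℝ}
    (hC : ∀ y, |X y| ≤ C) : Integrable X μ :=
  Integrable.of_bound hX.aestronglyMeasurable C (Eventually.of_forall hC)

lemma integral_comp_measurePreserving {f : α → ℝ} (hf : Measurable f) {T : α → α}
    {ν : Measure α} (hT : MeasurePreserving T ν ν) : ∫ y, f (T y) ∂ν = ∫ y, f y ∂ν := by
  conv_rhs => rw [← hT.map_eq]
  exact (integral_map hT.aemeasurable hf.aestronglyMeasurable).symm

end Moments

/-! ### Third moments of increments of the rescaled integrals -/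

section Increments

variable {Ω : Type u} [MetricSpace Ω] [MeasurableSpace Ω] [BorelSpace Ω] {φ : Flow ℝ Ω}
  {μ : Measure Ω} [IsProbabilityMeasure μ] {κ : ℝ≥0}

lemma measurable_flowIntegral {v : Ω → ℝ} (hv : Continuous v) (t : ℝ) :
    Measurable (flowIntegral φ v t) :=
  ((continuous_flowIntegral φ hv).comp (continuous_const.prodMk continuous_id)).measurable

lemma measurable_iteratedIntegral {v w : Ω → ℝ} (hv : Continuous v) (hw : Continuous w) (t : ℝ) :
    Measurable (iteratedIntegral φ v w t) :=
  ((continuous_iteratedIntegral φ hv hw).comp (continuous_const.prodMk continuous_id)).measurable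

/-- The moment assumption in the form of bounds for sixth and third moments. -/
lemma MomentBounds.exists_bound (h : MomentBounds φ κ μ) (v w : HolderZero κ μ) :
    ∃ K : ℝ, 0 < K ∧ ∀ t : ℝ, 0 ≤ t →
      ∫ y, |flowIntegral φ v t y| ^ 6 ∂μ ≤ (K * √t) ^ 6 ∧
      ∫ y, |iteratedIntegral φ v w t y| ^ 3 ∂μ ≤ (K * t) ^ 3 := by
  obtain ⟨p, hp, hK⟩ := h
  obtain ⟨K, hK0, hK⟩ := hK v w
  obtain ⟨C, hC⟩ := v.2.2.1
  obtain ⟨D, hD⟩ := w.2.2.1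
  refine ⟨K, hK0, fun t ht => ⟨?_, ?_⟩⟩
  · exact integral_abs_pow_le_of_rpow (q := 2 * p) (measurable_flowIntegral v.2.1 t)
      (abs_flowIntegral_le φ hC t) (by norm_num) (by push_cast; linarith)
      (by rw [Real.sqrt_eq_rpow]; exact (hK t ht).1)
  · exact integral_abs_pow_le_of_rpow (q := p) (measurable_iteratedIntegral v.2.1 w.2.1 t)
      (abs_iteratedIntegral_le φ hC hD t) (by norm_num) (by norm_num; linarith) (hK t ht).2

/-- Cubic moments of the increments of `n^{-1/2} ∫₀^{tn} v ∘ φ_s ds`. -/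
lemma exists_scaledW_increment_bound (hμ : IsErgodicFlow φ μ) (hmom : MomentBounds φ κ μ)
    (v : HolderZero κ μ) :
    ∃ C : ℝ, 0 ≤ C ∧ ∀ (n : ℕ) (s h : ℝ≥0),
      ∫ y, |(√n)⁻¹ * flowIntegral φ v ((s + h : ℝ≥0) * n) y -
        (√n)⁻¹ * flowIntegral φ v (s * n) y| ^ 3 ∂μ ≤ C * √h ^ 3 := by
  obtain ⟨K, hK0, hK⟩ := hmom.exists_bound v v
  obtain ⟨D, hD⟩ := v.2.2.1
  refine ⟨K ^ 3, by positivity, fun n s h => ?_⟩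
  -- For $n=0$ the factor `(√0)⁻¹` is $0$, so the increment vanishes.
  rcases n.eq_zero_or_pos with rfl | hn
  · simp; positivity
  have hn' : (0 : ℝ) < n := by exact_mod_cast hn
  have hmeas := measurable_flowIntegral (φ := φ) v.2.1 (h * n)
  have h6 := (hK (h * n) (by positivity)).1
  have h3 : ∫ y, |flowIntegral φ v (h * n) y| ^ 3 ∂μ ≤ (K * √(h * n)) ^ 3 := by
    refine integral_abs_pow_le_of_rpow (q := 6) hmeas (abs_flowIntegral_le φ hD _) (by norm_num)
      (by norm_num) ?_
    calc _ ≤ ((K * √(h * n)) ^ 6) ^ (1 / 6 : ℝ) := by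
          refine Real.rpow_le_rpow (integral_nonneg fun y => by positivity) ?_ (by norm_num)
          exact_mod_cast h6
      _ = K * √(h * n) := by
          rw [← Real.rpow_natCast, ← Real.rpow_mul (by positivity)]; norm_num
  have heq : ∀ y, |(√n)⁻¹ * flowIntegral φ v ((s + h : ℝ≥0) * n) y -
      (√n)⁻¹ * flowIntegral φ v (s * n) y| ^ 3 =
      (√n)⁻¹ ^ 3 * |flowIntegral φ v (h * n) (φ (s * n) y)| ^ 3 := fun y => by
    rw [NNReal.coe_add, add_mul, flowIntegral_add φ v.2.1, ← mul_sub, add_sub_cancel_left,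
      abs_mul, mul_pow, abs_of_nonneg (by positivity : 0 ≤ (√(n : ℝ))⁻¹)]
  simp only [heq]
  -- Stationarity removes the shift by $\phi_{sn}$, leaving a moment over a time $hn$ started at
  -- $0$.
  rw [integral_const_mul, integral_comp_measurePreserving
    (f := fun y => |flowIntegral φ v (h * n) y| ^ 3) (by fun_prop)
    (hμ.measurePreserving (s * n))]
  calc _ ≤ (√n)⁻¹ ^ 3 * (K * √(h * n)) ^ 3 := by gcongr
    _ = K ^ 3 * √h ^ 3 := by
      rw [Real.sqrt_mul (by positivity)]
      have : √(n : ℝ) ≠ 0 := by positivity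
      field_simp

lemma abs_add_pow_three_le (a b : ℝ) : |a + b| ^ 3 ≤ 4 * (|a| ^ 3 + |b| ^ 3) := by
  have h : |a + b| ^ 3 ≤ (|a| + |b|) ^ 3 := by gcongr; exact abs_add_le _ _
  -- For $a,b\ge0$: $4(a^3+b^3)-(a+b)^3=3(a+b)(a-b)^2$.
  nlinarith [mul_nonneg (add_nonneg (abs_nonneg a) (abs_nonneg b)) (sq_nonneg (|a| - |b|))]

/-- Cubic moments of the increments of `n^{-1} ∫₀^{tn} ∫₀ˢ v ∘ φ_r w ∘ φ_s dr ds`. -/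
lemma exists_scaledWW_increment_bound (hμ : IsErgodicFlow φ μ) (hmom : MomentBounds φ κ μ)
    (v w : HolderZero κ μ) (N : ℕ) :
    ∃ C : ℝ, 0 ≤ C ∧ ∀ (n : ℕ) (s h : ℝ≥0), s + h ≤ N →
      ∫ y, |(n : ℝ)⁻¹ * iteratedIntegral φ v w ((s + h : ℝ≥0) * n) y -
        (n : ℝ)⁻¹ * iteratedIntegral φ v w (s * n) y| ^ 3 ∂μ ≤ C * √h ^ 3 := by
  obtain ⟨K, hK0, hK⟩ := hmom.exists_bound v w
  -- `exists_bound` controls sixth moments for its first argument only; the product term in Chen's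
  -- relation needs them for `w` too.
  obtain ⟨L, hL0, hL⟩ := hmom.exists_bound w w
  obtain ⟨A, hA⟩ := v.2.2.1
  obtain ⟨B, hB⟩ := w.2.2.1
  -- The iterated term contributes $K^3h^3\le K^3N^{3/2}h^{3/2}$ and the product term
  -- $K^3L^3s^{3/2}h^{3/2}$ with $s\le N$; the $4$ comes from `abs_add_pow_three_le`.
  refine ⟨4 * (K ^ 3 * √N ^ 3 + K ^ 3 * L ^ 3 * √N ^ 3), by positivity, fun n s h hsh => ?_⟩
  rcases n.eq_zero_or_pos with rfl | hn
  · simp; positivity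
  have hn' : (0 : ℝ) < n := by exact_mod_cast hn
  have hshN : (s : ℝ) + h ≤ N := by exact_mod_cast hsh
  have hs0 := s.coe_nonneg
  have hh0 := h.coe_nonneg
  have hsN : √(s : ℝ) ≤ √N := Real.sqrt_le_sqrt (by linarith)
  have hhN : √(h : ℝ) ≤ √N := Real.sqrt_le_sqrt (by linarith)
  -- The cases $s=0$ and $h=0$ are separate because `integral_abs_mul_pow_three_le` needs positive
  -- bounds $A,B$, here multiples of $\sqrt{sn}$ and $\sqrt{hn}$.
  rcases hs0.eq_or_lt' with hs | hs
  · have hs' : s = 0 := by exact_mod_cast hs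
    subst hs'
    have heq : ∀ y, |(n : ℝ)⁻¹ * iteratedIntegral φ v w ((0 + h : ℝ≥0) * n) y -
        (n : ℝ)⁻¹ * iteratedIntegral φ v w ((0 : ℝ≥0) * n) y| ^ 3 =
        (n : ℝ)⁻¹ ^ 3 * |iteratedIntegral φ v w (h * n) y| ^ 3 := fun y => by
      rw [zero_add, NNReal.coe_zero, zero_mul]
      simp [iteratedIntegral, abs_mul, mul_pow]
    simp only [heq]
    rw [integral_const_mul]
    calc _ ≤ (n : ℝ)⁻¹ ^ 3 * (K * (h * n)) ^ 3 := by
          gcongr; exact (hK (h * n) (by positivity)).2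
      _ = K ^ 3 * √h ^ 3 * √h ^ 3 := by
          nth_rewrite 1 [← Real.sq_sqrt hh0]; field_simp
      _ ≤ 4 * (K ^ 3 * √N ^ 3 + K ^ 3 * L ^ 3 * √N ^ 3) * √h ^ 3 := by
          refine mul_le_mul_of_nonneg_right ?_ (by positivity)
          have h1 : K ^ 3 * √(h : ℝ) ^ 3 ≤ K ^ 3 * √N ^ 3 := by gcongr
          have h2 : 0 ≤ K ^ 3 * L ^ 3 * √N ^ 3 := by positivity
          have h3 : 0 ≤ K ^ 3 * √N ^ 3 := by positivity
          linarith
  rcases hh0.eq_or_lt' with hh | hh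
  · have hh' : h = 0 := by exact_mod_cast hh
    subst hh'
    simp
  have hmv := measurable_flowIntegral (φ := φ) v.2.1 (s * n)
  have hmw := measurable_flowIntegral (φ := φ) w.2.1 (h * n)
  have hmi := measurable_iteratedIntegral (φ := φ) v.2.1 w.2.1 (h * n)
  have hφ := (hμ.measurePreserving (s * n))
  have hmwφ := hmw.comp hφ.measurable
  have hmiφ := hmi.comp hφ.measurable
  -- By Chen's relation the increment is an iterated integral over time $hn$ along the shifted orbit
  -- plus a product of two Birkhoff integrals, the second of them shifted.
  have hle : ∀ y, |(n : ℝ)⁻¹ * iteratedIntegral φ v w ((s + h : ℝ≥0) * n) y -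
      (n : ℝ)⁻¹ * iteratedIntegral φ v w (s * n) y| ^ 3 ≤
      (n : ℝ)⁻¹ ^ 3 * (4 * (|iteratedIntegral φ v w (h * n) (φ (s * n) y)| ^ 3 +
        |flowIntegral φ v (s * n) y * flowIntegral φ w (h * n) (φ (s * n) y)| ^ 3)) := fun y => by
    rw [NNReal.coe_add, add_mul, iteratedIntegral_add φ v.2.1 w.2.1, ← mul_sub, add_assoc,
      add_sub_cancel_left, abs_mul, mul_pow, abs_of_nonneg (by positivity : 0 ≤ (n : ℝ)⁻¹)]
    gcongr
    exact abs_add_pow_three_le _ _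
  have i1 : Integrable (fun y => |iteratedIntegral φ v w (h * n) (φ (s * n) y)| ^ 3) μ :=
    integrable_of_measurable_of_bounded (C := (A * B * |(h : ℝ) * n| ^ 2) ^ 3)
      (hmiφ.norm.pow_const 3) fun y => by
        rw [abs_pow, abs_abs]; gcongr; exact abs_iteratedIntegral_le φ hA hB _ _
  have i2 : Integrable (fun y =>
      |flowIntegral φ v (s * n) y * flowIntegral φ w (h * n) (φ (s * n) y)| ^ 3) μ :=
    integrable_of_measurable_of_bounded (C := ((A * |(s : ℝ) * n|) * (B * |(h : ℝ) * n|)) ^ 3)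
      ((hmv.mul hmwφ).norm.pow_const 3) fun y => by
        have hA0 : 0 ≤ A := (abs_nonneg _).trans (hA y)
        rw [abs_pow, abs_abs, abs_mul]; gcongr <;> exact abs_flowIntegral_le φ (by assumption) _ _
  have b1 : ∫ y, |iteratedIntegral φ v w (h * n) (φ (s * n) y)| ^ 3 ∂μ ≤ (K * (h * n)) ^ 3 := by
    rw [integral_comp_measurePreserving
      (f := fun y => |iteratedIntegral φ v w (h * n) y| ^ 3) (by fun_prop) hφ]
    exact (hK (h * n) (by positivity)).2
  have b2 : ∫ y, |flowIntegral φ v (s * n) y * flowIntegral φ w (h * n) (φ (s * n) y)| ^ 3 ∂μ ≤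
      (K * √(s * n)) ^ 3 * (L * √(h * n)) ^ 3 := by
    refine integral_abs_mul_pow_three_le hmv hmwφ (abs_flowIntegral_le φ hA _)
      (fun y => abs_flowIntegral_le φ hB _ _) (by positivity) (by positivity)
      (hK (s * n) (by positivity)).1 ?_
    have := integral_comp_measurePreserving (f := fun y => |flowIntegral φ w (h * n) y| ^ 6)
      (by fun_prop) hφ
    simp only [Function.comp_apply]
    rw [this]
    exact (hL (h * n) (by positivity)).1
  calc _ ≤ ∫ y, (n : ℝ)⁻¹ ^ 3 * (4 * (|iteratedIntegral φ v w (h * n) (φ (s * n) y)| ^ 3 +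
        |flowIntegral φ v (s * n) y * flowIntegral φ w (h * n) (φ (s * n) y)| ^ 3)) ∂μ :=
        integral_mono_of_nonneg (Eventually.of_forall fun y => by positivity)
          (((i1.add i2).const_mul 4).const_mul _) (Eventually.of_forall hle)
    _ ≤ (n : ℝ)⁻¹ ^ 3 * (4 * ((K * (h * n)) ^ 3 + (K * √(s * n)) ^ 3 * (L * √(h * n)) ^ 3)) := by
        rw [integral_const_mul, integral_const_mul, integral_add i1 i2]
        gcongr
    _ = 4 * (K ^ 3 * √h ^ 3 + K ^ 3 * L ^ 3 * √s ^ 3) * √h ^ 3 := by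
        rw [Real.sqrt_mul hs0, Real.sqrt_mul hh0]
        have e1 : (K * (h * n)) ^ 3 = K ^ 3 * (√h ^ 3 * √h ^ 3) * (n : ℝ) ^ 3 := by
          nth_rewrite 1 [← Real.sq_sqrt hh0]; ring
        have e2 : (K * (√(s : ℝ) * √(n : ℝ))) ^ 3 * (L * (√(h : ℝ) * √(n : ℝ))) ^ 3 =
            K ^ 3 * L ^ 3 * √s ^ 3 * √h ^ 3 * (n : ℝ) ^ 3 := by
          nth_rewrite 3 [← Real.sq_sqrt hn'.le]; ring
        rw [e1, e2]
        field_simp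
    _ ≤ _ := by gcongr

end Increments

/-! ### Weak convergence in the supremum norm from moments of increments -/

section Interpolation

/-- The grid point `j / 64 ^ k`. -/
def gridPoint (k j : ℕ) : ℝ≥0 := j / 64 ^ k

/-- The grid of mesh `64⁻ᵏ` on `[0, N]`. -/
def grid (N k : ℕ) : Finset ℝ≥0 := (Finset.range (N * 64 ^ k + 1)).image (gridPoint k)

/-- The hat function of width `64⁻ᵏ` centred at `i`. -/
def hat (k : ℕ) (i t : ℝ≥0) : ℝ := max 0 (1 - 64 ^ k * dist t i)

/-- The hats, normalised by their sum, form a partition of unity: interpolated values are convex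
combinations of values at grid points closer than one mesh width. -/
lemma hat_nonneg (k : ℕ) (i t : ℝ≥0) : 0 ≤ hat k i t := le_max_left _ _

lemma continuous_hat (k : ℕ) (i : ℝ≥0) : Continuous (hat k i) := by
  unfold hat; fun_prop

lemma hat_pos_iff {k : ℕ} {i t : ℝ≥0} : 0 < hat k i t ↔ 64 ^ k * dist t i < 1 := by
  simp [hat]

lemma mul_dist_gridPoint (k j : ℕ) (t : ℝ≥0) :
    64 ^ k * dist t (gridPoint k j) = |(t : ℝ) * 64 ^ k - j| := by
  have h : (0 : ℝ) < 64 ^ k := by positivity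
  rw [NNReal.dist_eq, gridPoint]
  nth_rewrite 1 [← abs_of_pos h]
  rw [← abs_mul]
  push_cast
  congr 1
  field_simp

lemma gridPoint_mem_grid {N k j : ℕ} (h : j ≤ N * 64 ^ k) : gridPoint k j ∈ grid N k :=
  Finset.mem_image_of_mem _ (Finset.mem_range.2 (Nat.lt_succ_of_le h))

lemma floor_mul_lt {N : ℕ} (k : ℕ) {t : ℝ≥0} (ht : t < N) : ⌊t * 64 ^ k⌋₊ < N * 64 ^ k := by
  rw [Nat.floor_lt (by positivity)]
  push_cast
  gcongr

lemma abs_sub_floor_lt_one (k : ℕ) (t : ℝ≥0) :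
    |(t : ℝ) * 64 ^ k - (⌊t * 64 ^ k⌋₊ : ℕ)| < 1 := by
  have h1 : ((⌊t * 64 ^ k⌋₊ : ℕ) : ℝ≥0) ≤ t * 64 ^ k := Nat.floor_le (by positivity)
  have h2 := Nat.lt_floor_add_one (t * 64 ^ k)
  have h1' : ((⌊t * 64 ^ k⌋₊ : ℕ) : ℝ) ≤ t * 64 ^ k := by exact_mod_cast h1
  have h2' : (t : ℝ) * 64 ^ k < (⌊t * 64 ^ k⌋₊ : ℕ) + 1 := by exact_mod_cast h2
  rw [abs_lt]
  constructor <;> linarith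

/-- The grid point just below $t$ is less than one mesh width away, so its hat is positive at $t$.
-/
lemma sum_hat_pos {N : ℕ} (k : ℕ) {t : ℝ≥0} (ht : t < N) : 0 < ∑ i : grid N k, hat k i t :=
  Finset.sum_pos' (fun _ _ => hat_nonneg _ _ _)
    ⟨⟨_, gridPoint_mem_grid (floor_mul_lt k ht).le⟩, Finset.mem_univ _, hat_pos_iff.2 (by
      rw [mul_dist_gridPoint]; exact abs_sub_floor_lt_one k t)⟩

variable {E : Type} [NormedAddCommGroup E] [NormedSpace ℝ E]

/-- The function on `[0, N)` interpolating the values `x` on the grid. -/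
def interp (N k : ℕ) (x : grid N k → E) (t : ℝ≥0) : E :=
  (∑ i : grid N k, hat k i t)⁻¹ • ∑ i : grid N k, hat k i t • x i

/-- The grid extends to $\lceil T\rceil+1$ so that every $t\le T$ lies strictly below its right end,
as the floor estimates require. -/
lemma lt_ceil_add_one {T : ℝ≥0} (t : Icc (0 : ℝ≥0) T) : (t : ℝ≥0) < (⌈T⌉₊ + 1 : ℕ) := by
  push_cast
  exact (t.2.2.trans (Nat.le_ceil T)).trans_lt (lt_add_one _)

lemma continuous_interp (T : ℝ≥0) (k : ℕ) :
    Continuous fun p : (grid (⌈T⌉₊ + 1) k → E) × Icc (0 : ℝ≥0) T => interp (⌈T⌉₊ + 1) k p.1 p.2 := by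
  have h (i : ℝ≥0) : Continuous fun p : (grid (⌈T⌉₊ + 1) k → E) × Icc (0 : ℝ≥0) T =>
      hat k i p.2 := (continuous_hat k i).comp (continuous_subtype_val.comp continuous_snd)
  unfold interp
  refine Continuous.smul (Continuous.inv₀ (continuous_finsetSum _ fun i _ => h i)
    fun p => (sum_hat_pos k (lt_ceil_add_one p.2)).ne') (continuous_finsetSum _ fun i _ => ?_)
  exact (h i).smul ((continuous_apply i).comp continuous_fst)

/-- The interpolation of values on the grid as a path on `[0, T]`. -/
def interpPath (T : ℝ≥0) (k : ℕ) (x : grid (⌈T⌉₊ + 1) k → E) : C(Icc (0 : ℝ≥0) T, E) :=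
  ⟨fun t => interp (⌈T⌉₊ + 1) k x t, by
    have h := (continuous_interp (E := E) T k).comp (Continuous.prodMk_right x)
    exact h⟩

lemma continuous_interpPath (T : ℝ≥0) (k : ℕ) :
    Continuous (interpPath T k : (grid (⌈T⌉₊ + 1) k → E) → C(Icc (0 : ℝ≥0) T, E)) :=
  ContinuousMap.continuous_of_continuous_uncurry _ (continuous_interp T k)

lemma dist_interp_le {N k : ℕ} {f : ℝ≥0 → E} {t : ℝ≥0} (ht : t < N) {D : ℝ}
    (h : ∀ i ∈ grid N k, 64 ^ k * dist t i < 1 → dist (f t) (f i) ≤ D) :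
    dist (f t) (interp N k ((grid N k).restrict f) t) ≤ D := by
  have hS := sum_hat_pos k ht
  have heq : f t - interp N k ((grid N k).restrict f) t =
      (∑ i : grid N k, hat k i t)⁻¹ • ∑ i : grid N k, hat k i t • (f t - f i) := by
    simp only [interp, smul_sub, Finset.sum_sub_distrib, ← Finset.sum_smul]
    rw [inv_smul_smul₀ hS.ne']
    rfl
  rw [dist_eq_norm, heq, norm_smul, norm_inv, Real.norm_of_nonneg hS.le, inv_mul_le_iff₀ hS,
    Finset.sum_mul]
  refine norm_sum_le_of_le _ fun i _ => ?_
  rw [norm_smul, Real.norm_of_nonneg (hat_nonneg _ _ _)]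
  rcases (hat_nonneg k i t).eq_or_lt with h0 | h0
  · simp [← h0]
  · rw [← dist_eq_norm]
    gcongr
    exact h i i.2 (hat_pos_iff.1 h0)

lemma toPath_apply {E : Type} [NormedAddCommGroup E] {T : ℝ≥0} {f : ℝ≥0 → E}
    (hf : Continuous f) (t : Icc (0 : ℝ≥0) T) : toPath T f t = f t := by
  simp [toPath, hf.continuousOn]

lemma dist_toPath_interpPath_le {T : ℝ≥0} {k : ℕ} {f : ℝ≥0 → E} (hf : Continuous f) {D : ℝ}
    (hD : 0 ≤ D) (h : ∀ t : ℝ≥0, t < (⌈T⌉₊ + 1 : ℕ) → ∀ i ∈ grid (⌈T⌉₊ + 1) k,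
      64 ^ k * dist t i < 1 → dist (f t) (f i) ≤ D) :
    dist (toPath T f) (interpPath T k ((grid (⌈T⌉₊ + 1) k).restrict f)) ≤ D := by
  rw [ContinuousMap.dist_le hD]
  intro t
  rw [toPath_apply hf]
  exact dist_interp_le (lt_ceil_add_one t) (h t (lt_ceil_add_one t))

lemma mem_grid_le {N k : ℕ} {i : ℝ≥0} (hi : i ∈ grid N k) : i ≤ N := by
  obtain ⟨j, hj, rfl⟩ := Finset.mem_image.1 hi
  rw [gridPoint, div_le_iff₀ (by positivity)]
  exact_mod_cast Nat.lt_succ_iff.1 (Finset.mem_range.1 hj)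

lemma tendsto_interpPath (T : ℝ≥0) {f : ℝ≥0 → E} (hf : Continuous f) :
    Tendsto (fun k => interpPath T k ((grid (⌈T⌉₊ + 1) k).restrict f)) atTop (𝓝 (toPath T f)) := by
  rw [Metric.tendsto_atTop]
  intro ε hε
  obtain ⟨δ, hδ, h⟩ := Metric.uniformContinuousOn_iff.1
    ((isCompact_Icc (a := (0 : ℝ≥0)) (b := (⌈T⌉₊ + 1 : ℕ))).uniformContinuousOn_of_continuous
      hf.continuousOn) (ε / 2) (by positivity)
  obtain ⟨n, hn⟩ := pow_unbounded_of_one_lt δ⁻¹ (by norm_num : (1 : ℝ) < 64)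
  refine ⟨n, fun k hk => ?_⟩
  rw [dist_comm]
  refine (dist_toPath_interpPath_le hf (half_pos hε).le fun t ht i hi hti => ?_).trans_lt
    (half_lt_self hε)
  refine (h t ⟨zero_le, ht.le⟩ i ⟨zero_le, mem_grid_le hi⟩ ?_).le
  have h1 : δ⁻¹ < 64 ^ k := hn.trans_le (pow_le_pow_right₀ (by norm_num) hk)
  have h2 : δ⁻¹ * dist t i < 1 := by
    refine lt_of_le_of_lt ?_ hti
    gcongr
  rwa [inv_mul_lt_iff₀ hδ, mul_one] at h2

variable [MeasurableSpace E] [BorelSpace E] [SecondCountableTopology E]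

/-- The random path is an almost sure limit of its interpolations, each a continuous function of
finitely many marginals. -/
lemma aemeasurable_toPath {α : Type*} [MeasurableSpace α] {P : Measure α} {Y : ℝ≥0 → α → E}
    (hm : ∀ t, AEMeasurable (Y t) P) (hc : ∀ᵐ ω ∂P, Continuous fun t => Y t ω) (T : ℝ≥0) :
    AEMeasurable (fun ω => toPath T fun t => Y t ω) P := by
  refine aemeasurable_of_tendsto_metrizable_ae atTop
    (f := fun k ω => interpPath T k ((grid (⌈T⌉₊ + 1) k).restrict fun t => Y t ω)) (fun k => ?_) ?_
  · exact (continuous_interpPath T k).measurable.comp_aemeasurable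
      (aemeasurable_pi_lambda _ fun i => hm i)
  · filter_upwards [hc] with ω hω using tendsto_interpPath T hω

end Interpolation

/-! ### Chaining over the grids of mesh $64^{-l}$ -/

section Chaining

variable {E : Type} [NormedAddCommGroup E]

/-- An upper bound for the increments of `f` between neighbouring points of the grid of
mesh `64⁻ˡ` which is additive in the cubes of the increments. -/
def cubicModulus (N : ℕ) (f : ℝ≥0 → E) (l : ℕ) : ℝ≥0∞ :=
  2⁻¹ ^ l + 4 ^ l * ∑ j ∈ Finset.range (N * 64 ^ l),
    ‖f (gridPoint l (j + 1)) - f (gridPoint l j)‖ₑ ^ 3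

/-- If $x\ge2^{-l}$ then $4^lx^2\ge1$. This replaces a cube root by an expression affine in $x^3$,
so a maximum of increments can be integrated term by term. -/
lemma le_add_four_pow_mul_cube (x : ℝ≥0∞) (l : ℕ) : x ≤ 2⁻¹ ^ l + 4 ^ l * x ^ 3 := by
  rcases le_total x (2⁻¹ ^ l) with h | h
  · exact h.trans le_self_add
  · refine le_trans ?_ le_add_self
    have h4 : (4 : ℝ≥0∞) ^ l * (2⁻¹ ^ l * 2⁻¹ ^ l) = 1 := by
      rw [← mul_pow, ← mul_pow, ← ENNReal.mul_inv (by simp) (by simp)]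
      norm_num
      rw [ENNReal.mul_inv_cancel (by simp) (by simp), one_pow]
    calc x = 4 ^ l * (2⁻¹ ^ l * 2⁻¹ ^ l) * x := by rw [h4, one_mul]
      _ ≤ 4 ^ l * (x * x) * x := by gcongr
      _ = 4 ^ l * x ^ 3 := by ring

lemma edist_gridPoint_le {N : ℕ} (f : ℝ≥0 → E) {l j : ℕ} (hj : j < N * 64 ^ l) :
    edist (f (gridPoint l j)) (f (gridPoint l (j + 1))) ≤ cubicModulus N f l := by
  rw [edist_comm, edist_eq_enorm_sub]
  refine (le_add_four_pow_mul_cube _ l).trans ?_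
  unfold cubicModulus
  gcongr
  exact Finset.single_le_sum (f := fun j => ‖f (gridPoint l (j + 1)) - f (gridPoint l j)‖ₑ ^ 3)
    (fun _ _ => zero_le) (Finset.mem_range.2 hj)

lemma gridPoint_succ_mul (l j : ℕ) : gridPoint (l + 1) (64 * j) = gridPoint l j := by
  unfold gridPoint
  push_cast
  rw [pow_succ']
  exact mul_div_mul_left _ _ (by norm_num)

/-- Passing from the level-$l$ floor of $t$ to the level-$(l+1)$ floor takes fewer than $64$ steps
of the finer grid. -/
lemma edist_floor_succ_le {N : ℕ} (f : ℝ≥0 → E) (l : ℕ) {t : ℝ≥0} (ht : t < N) :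
    edist (f (gridPoint l ⌊t * 64 ^ l⌋₊)) (f (gridPoint (l + 1) ⌊t * 64 ^ (l + 1)⌋₊)) ≤
      64 * cubicModulus N f (l + 1) := by
  rw [← gridPoint_succ_mul]
  have hle : 64 * ⌊t * 64 ^ l⌋₊ ≤ ⌊t * 64 ^ (l + 1)⌋₊ := by
    refine Nat.le_floor ?_
    push_cast
    calc 64 * ((⌊t * 64 ^ l⌋₊ : ℕ) : ℝ≥0) ≤ 64 * (t * 64 ^ l) := by
          gcongr; exact Nat.floor_le (by positivity)
      _ = t * 64 ^ (l + 1) := by ring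
  have hlt : ⌊t * 64 ^ (l + 1)⌋₊ < 64 * ⌊t * 64 ^ l⌋₊ + 64 := by
    rw [Nat.floor_lt (by positivity)]
    push_cast
    calc t * 64 ^ (l + 1) = 64 * (t * 64 ^ l) := by ring
      _ < 64 * ((⌊t * 64 ^ l⌋₊ : ℕ) + 1) := by gcongr; exact Nat.lt_floor_add_one _
      _ = _ := by ring
  refine (edist_le_Ico_sum_of_edist_le (f := fun j => f (gridPoint (l + 1) j)) hle
    (d := fun _ => cubicModulus N f (l + 1)) fun {j} _ hj => ?_).trans ?_
  · exact edist_gridPoint_le f (hj.trans (floor_mul_lt (l + 1) ht))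
  · rw [Finset.sum_const, Nat.card_Ico, nsmul_eq_mul]
    gcongr
    have : ⌊t * 64 ^ (l + 1)⌋₊ - 64 * ⌊t * 64 ^ l⌋₊ ≤ 64 := by omega
    calc ((⌊t * 64 ^ (l + 1)⌋₊ - 64 * ⌊t * 64 ^ l⌋₊ : ℕ) : ℝ≥0∞) ≤ (64 : ℕ) := Nat.cast_le.2 this
      _ = 64 := by norm_num

lemma tendsto_gridPoint_floor (t : ℝ≥0) :
    Tendsto (fun k => gridPoint k ⌊t * 64 ^ k⌋₊) atTop (𝓝 t) := by
  rw [tendsto_iff_dist_tendsto_zero]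
  refine squeeze_zero (fun _ => dist_nonneg) (fun k => ?_)
    (tendsto_pow_atTop_nhds_zero_of_lt_one (r := (64 : ℝ)⁻¹) (by norm_num) (by norm_num))
  have h := (mul_dist_gridPoint k ⌊t * 64 ^ k⌋₊ t).trans_lt (abs_sub_floor_lt_one k t)
  rw [dist_comm, inv_pow, ← one_div, le_div_iff₀ (by positivity), mul_comm]
  exact h.le

/-- The floors of $t$ on successive grids converge to $t$, so by continuity of $f$ the increments
along them telescope. -/
lemma edist_gridPoint_floor_le {N : ℕ} {f : ℝ≥0 → E} (hf : Continuous f) (k : ℕ) {t : ℝ≥0}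
    (ht : t < N) : edist (f (gridPoint k ⌊t * 64 ^ k⌋₊)) (f t) ≤
      ∑' m, 64 * cubicModulus N f (k + m + 1) :=
  edist_le_tsum_of_edist_le_of_tendsto (fun l => 64 * cubicModulus N f (l + 1))
    (fun l => edist_floor_succ_le f l ht) ((hf.tendsto t).comp (tendsto_gridPoint_floor t)) k

lemma edist_grid_le {N : ℕ} {f : ℝ≥0 → E} (hf : Continuous f) (k : ℕ) {t i : ℝ≥0}
    (ht : t < N) (hi : i ∈ grid N k) (hti : 64 ^ k * dist t i < 1) :
    edist (f t) (f i) ≤ ∑' m, 64 * cubicModulus N f (k + m) := by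
  obtain ⟨j, -, rfl⟩ := Finset.mem_image.1 hi
  rw [mul_dist_gridPoint, abs_lt] at hti
  have h1 : ((⌊t * 64 ^ k⌋₊ : ℕ) : ℝ≥0) ≤ t * 64 ^ k := Nat.floor_le (by positivity)
  have h2 := Nat.lt_floor_add_one (t * 64 ^ k)
  have hf' := edist_gridPoint_floor_le hf k ht
  have hJ := floor_mul_lt k ht
  generalize ⌊t * 64 ^ k⌋₊ = J at h1 h2 hf' hJ
  replace h1 : (J : ℝ) ≤ t * 64 ^ k := by exact_mod_cast h1
  replace h2 : (t : ℝ) * 64 ^ k < J + 1 := by exact_mod_cast h2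
  have hj1 : J < j + 1 := by
    have : (J : ℝ) < j + 1 := by linarith
    exact_mod_cast this
  have hj2 : j < J + 2 := by
    have : (j : ℝ) < J + 2 := by linarith
    exact_mod_cast this
  have h3 : edist (f (gridPoint k J)) (f (gridPoint k j)) ≤ 64 * cubicModulus N f k := by
    rcases (by omega : j = J ∨ j = J + 1) with rfl | rfl
    · simp
    · refine (edist_gridPoint_le f hJ).trans ?_
      exact le_mul_of_one_le_left zero_le (by norm_num)
  -- The term $m=0$ pays for the step from the floor $J$ to its neighbour $j$; the terms $m\ge1$ pay
  -- for the chain from $J$ to $t$.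
  rw [tsum_eq_zero_add' ENNReal.summable, add_comm]
  refine (edist_triangle _ (f (gridPoint k J)) _).trans (add_le_add ?_ h3)
  rwa [edist_comm]

lemma edist_toPath_interpPath_le [NormedSpace ℝ E] (T : ℝ≥0) (k : ℕ) {f : ℝ≥0 → E}
    (hf : Continuous f) : edist (toPath T f) (interpPath T k ((grid (⌈T⌉₊ + 1) k).restrict f)) ≤
      ∑' m, 64 * cubicModulus (⌈T⌉₊ + 1) f (k + m) := by
  rcases eq_or_ne (∑' m, 64 * cubicModulus (⌈T⌉₊ + 1) f (k + m)) ⊤ with h | h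
  · rw [h]; exact le_top
  · rw [edist_dist]
    refine ENNReal.ofReal_le_of_le_toReal
      (dist_toPath_interpPath_le hf ENNReal.toReal_nonneg fun t ht i hi hti => ?_)
    have := edist_grid_le hf k ht hi hti
    rw [edist_dist] at this
    exact (ENNReal.ofReal_le_iff_le_toReal h).1 this

end Chaining

/-! ### From increment moments and marginals to weak convergence -/

section WeakConvergence

variable {E : Type} [NormedAddCommGroup E] [MeasurableSpace E]
  [BorelSpace E] [SecondCountableTopology E]

lemma gridPoint_succ (l j : ℕ) : gridPoint l (j + 1) = gridPoint l j + (64 ^ l)⁻¹ := by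
  simp [gridPoint, add_div]

/-- Since $64=8^2$, the rate $h^{3/2}$ at mesh $h=64^{-l}$ is the integer power $8^{-3l}=512^{-l}$.
-/
lemma ofReal_sqrt_mesh_pow_three (l : ℕ) :
    ENNReal.ofReal (√(((64 ^ l)⁻¹ : ℝ≥0) : ℝ) ^ 3) = 512⁻¹ ^ l := by
  have h : √(((64 ^ l)⁻¹ : ℝ≥0) : ℝ) = (8 ^ l)⁻¹ := by
    rw [Real.sqrt_eq_iff_mul_self_eq (by positivity) (by positivity)]
    push_cast
    rw [← mul_inv, ← mul_pow]
    norm_num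
  rw [h, ← inv_pow, ← pow_mul, mul_comm, pow_mul, ENNReal.ofReal_pow (by positivity)]
  congr 1
  rw [inv_pow, ENNReal.ofReal_inv_of_pos (by norm_num)]
  norm_num

variable {α : Type*} [MeasurableSpace α] {μ : Measure α} [IsProbabilityMeasure μ]

lemma aemeasurable_cubicModulus {ν : Measure α} {X : ℝ≥0 → α → E}
    (hX : ∀ t, AEMeasurable (X t) ν) (N l : ℕ) :
    AEMeasurable (fun y => cubicModulus N (fun t => X t y) l) ν := by
  unfold cubicModulus
  refine (AEMeasurable.const_mul (Finset.aemeasurable_fun_sum _ fun j _ => ?_) _).const_add _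
  exact (((hX _).sub (hX _)).enorm).pow_const 3

/-- There are $N\,64^l$ increments, each with third moment at most $C\,512^{-l}$ and weight $4^l$,
and $4\cdot64/512=1/2$. The exponent $3/2>1$ of the increment bound leaves this decay. -/
lemma lintegral_cubicModulus_le {X : ℝ≥0 → α → E} (hX : ∀ t, AEMeasurable (X t) μ) {N : ℕ}
    {C : ℝ≥0∞} (hinc : ∀ s h : ℝ≥0, s + h ≤ N →
      ∫⁻ y, ‖X (s + h) y - X s y‖ₑ ^ 3 ∂μ ≤ C * ENNReal.ofReal (√h ^ 3)) (l : ℕ) :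
    ∫⁻ y, cubicModulus N (fun t => X t y) l ∂μ ≤ (1 + N * C) * 2⁻¹ ^ l := by
  have hm : ∀ j, AEMeasurable
      (fun y => ‖X (gridPoint l (j + 1)) y - X (gridPoint l j) y‖ₑ ^ 3) μ := fun j =>
    (((hX _).sub (hX _)).enorm).pow_const 3
  have hle : ∀ j ∈ Finset.range (N * 64 ^ l),
      ∫⁻ y, ‖X (gridPoint l (j + 1)) y - X (gridPoint l j) y‖ₑ ^ 3 ∂μ ≤ C * 512⁻¹ ^ l := by
    intro j hj
    rw [gridPoint_succ, ← ofReal_sqrt_mesh_pow_three]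
    refine hinc _ _ ?_
    rw [← gridPoint_succ]
    exact mem_grid_le (gridPoint_mem_grid (Finset.mem_range.1 hj))
  unfold cubicModulus
  rw [lintegral_add_left measurable_const, lintegral_const_mul'' _
    (Finset.aemeasurable_fun_sum _ fun j _ => hm j), lintegral_finsetSum' _ fun j _ => hm j]
  have h : (4 : ℝ≥0∞) ^ l * (64 ^ l * 512⁻¹ ^ l) = 2⁻¹ ^ l := by
    rw [← mul_pow, ← mul_pow]
    congr 1
    rw [← mul_assoc, ← div_eq_mul_inv, ENNReal.div_eq_inv_mul]
    rw [show (4 : ℝ≥0∞) * 64 = 256 by norm_num, show (512 : ℝ≥0∞) = 256 * 2 by norm_num,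
      ENNReal.mul_inv (by simp) (by simp), mul_right_comm, ENNReal.inv_mul_cancel (by simp) (by simp),
      one_mul]
  calc _ ≤ (∫⁻ _, 2⁻¹ ^ l ∂μ) + 4 ^ l * ((N * 64 ^ l : ℕ) * (C * 512⁻¹ ^ l)) := by
        gcongr
        refine (Finset.sum_le_sum hle).trans ?_
        simp
    _ = (1 + N * C) * 2⁻¹ ^ l := by
        rw [lintegral_const, measure_univ, mul_one]
        push_cast
        rw [add_mul, one_mul, ← h]
        ring

/-- The interpolation error on the grid of mesh `64⁻ᵏ` is of order `2⁻ᵏ` in mean. -/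
lemma lintegral_edist_interpPath_le [NormedSpace ℝ E] {X : ℝ≥0 → α → E}
    (hX : ∀ t, AEMeasurable (X t) μ) (hc : ∀ᵐ y ∂μ, Continuous fun t => X t y) (T : ℝ≥0)
    {C : ℝ≥0∞} (hinc : ∀ s h : ℝ≥0, s + h ≤ (⌈T⌉₊ + 1 : ℕ) →
      ∫⁻ y, ‖X (s + h) y - X s y‖ₑ ^ 3 ∂μ ≤ C * ENNReal.ofReal (√h ^ 3)) (k : ℕ) :
    ∫⁻ y, edist (toPath T fun t => X t y)
      (interpPath T k ((grid (⌈T⌉₊ + 1) k).restrict fun t => X t y)) ∂μ ≤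
      128 * (1 + (⌈T⌉₊ + 1 : ℕ) * C) * 2⁻¹ ^ k := by
  calc _ ≤ ∫⁻ y, ∑' m, 64 * cubicModulus (⌈T⌉₊ + 1) (fun t => X t y) (k + m) ∂μ := by
        refine lintegral_mono_ae ?_
        filter_upwards [hc] with y hy using edist_toPath_interpPath_le T k hy
    _ = ∑' m, 64 * ∫⁻ y, cubicModulus (⌈T⌉₊ + 1) (fun t => X t y) (k + m) ∂μ := by
        rw [lintegral_tsum fun m => (aemeasurable_cubicModulus hX _ _).const_mul _]
        congr 1
        ext m
        rw [lintegral_const_mul'' _ (aemeasurable_cubicModulus hX _ _)]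
    _ ≤ ∑' m, 64 * ((1 + (⌈T⌉₊ + 1 : ℕ) * C) * 2⁻¹ ^ (k + m)) := by
        gcongr with m
        exact lintegral_cubicModulus_le hX hinc _
    _ = 64 * (1 + (⌈T⌉₊ + 1 : ℕ) * C) * 2⁻¹ ^ k * ∑' m, 2⁻¹ ^ m := by
        rw [← ENNReal.tsum_mul_left]
        congr 1
        ext m
        rw [pow_add]
        ring
    -- The factor $128$ is $64\sum_m2^{-m}$.
    _ = _ := by
        rw [ENNReal.tsum_geometric, ENNReal.one_sub_inv_two, inv_inv]
        ring

lemma integrable_comp_of_bounded {S : Type*} [TopologicalSpace S] [MeasurableSpace S]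
    [BorelSpace S] {F : S → ℝ} (hF : Continuous F) {M : ℝ} (hM : ∀ x y, dist (F x) (F y) ≤ M)
    {Y : α → S} (hY : AEMeasurable Y μ) : Integrable (fun y => F (Y y)) μ := by
  obtain ⟨y₀⟩ : Nonempty α := nonempty_of_isProbabilityMeasure μ
  refine Integrable.of_bound (hF.measurable.comp_aemeasurable hY).aestronglyMeasurable
    (‖F (Y y₀)‖ + M) (Eventually.of_forall fun y => ?_)
  have h := hM (Y y) (Y y₀)
  rw [dist_eq_norm] at h
  have h2 := norm_le_norm_add_norm_sub' (F (Y y)) (F (Y y₀))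
  linarith

lemma abs_integral_sub_le_of_lipschitz {S : Type*} [PseudoEMetricSpace S] [MeasurableSpace S]
    [BorelSpace S] {F : S → ℝ} {L : ℝ≥0} (hF : LipschitzWith L F) {M : ℝ}
    (hM : ∀ x y, dist (F x) (F y) ≤ M) {Y Y' : α → S} (hY : AEMeasurable Y μ)
    (hY' : AEMeasurable Y' μ) {D : ℝ≥0∞} (hD : D ≠ ⊤) (h : ∫⁻ y, edist (Y y) (Y' y) ∂μ ≤ D) :
    |∫ y, F (Y y) ∂μ - ∫ y, F (Y' y) ∂μ| ≤ L * D.toReal := by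
  rw [← integral_sub (integrable_comp_of_bounded hF.continuous hM hY)
    (integrable_comp_of_bounded hF.continuous hM hY'), ← Real.norm_eq_abs]
  refine (norm_integral_le_lintegral_norm _).trans ?_
  rw [← ENNReal.coe_toReal, ← ENNReal.toReal_mul]
  refine ENNReal.toReal_mono (ENNReal.mul_ne_top ENNReal.coe_ne_top hD) ?_
  calc _ ≤ ∫⁻ y, L * edist (Y y) (Y' y) ∂μ := by
        refine lintegral_mono fun y => ?_
        have := hF (Y y) (Y' y)
        rwa [edist_dist, dist_eq_norm] at this
    _ = L * ∫⁻ y, edist (Y y) (Y' y) ∂μ := lintegral_const_mul' _ _ ENNReal.coe_ne_top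
    _ ≤ L * D := by gcongr

/-- Convergence of finite-dimensional distributions together with a uniform bound of the third
moments of the increments implies weak convergence in the supremum norm. -/
theorem TendstoFDD.tendstoWeaklySup [NormedSpace ℝ E] {Ξ : Type w} [MeasurableSpace Ξ]
    {P : Measure Ξ} [IsProbabilityMeasure P] {Ω : Type u} [MeasurableSpace Ω] {μ : Measure Ω}
    [IsProbabilityMeasure μ] {X : ℕ → ℝ≥0 → Ω → E} {Z : ℝ≥0 → Ξ → E}
    (hfdd : TendstoFDD X μ Z P) (hX : ∀ n t, AEMeasurable (X n t) μ)
    (hXc : ∀ n, ∀ᵐ y ∂μ, Continuous fun t => X n t y) (hZ : ∀ t, AEMeasurable (Z t) P)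
    (hZc : ∀ᵐ ω ∂P, Continuous fun t => Z t ω)
    (hinc : ∀ N : ℕ, ∃ C : ℝ≥0∞, C ≠ ⊤ ∧ ∀ (n : ℕ) (s h : ℝ≥0), s + h ≤ N →
      ∫⁻ y, ‖X n (s + h) y - X n s y‖ₑ ^ 3 ∂μ ≤ C * ENNReal.ofReal (√h ^ 3)) :
    TendstoWeaklySup X μ Z P := by
  refine ⟨hXc, hZc, fun T => ?_⟩
  have hXm : ∀ n, AEMeasurable (fun y => toPath T fun t => X n t y) μ := fun n =>
    aemeasurable_toPath (hX n) (hXc n) T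
  have hZm : AEMeasurable (fun ω => toPath T fun t => Z t ω) P := aemeasurable_toPath hZ hZc T
  refine ⟨hXm, hZm, ?_⟩
  -- Bounded Lipschitz test functions suffice, and for these the mean interpolation error bounds the
  -- difference of expectations.
  refine tendsto_iff_forall_lipschitz_integral_tendsto.2 ?_
  rintro F ⟨M, hM⟩ ⟨L, hL⟩
  simp only [ProbabilityMeasure.coe_mk]
  simp_rw [integral_map (hXm _) hL.continuous.aestronglyMeasurable]
  rw [integral_map hZm hL.continuous.aestronglyMeasurable]
  obtain ⟨C, hC, hinc⟩ := hinc (⌈T⌉₊ + 1)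
  have hgX : ∀ n k, AEMeasurable
      (fun y => interpPath T k ((grid (⌈T⌉₊ + 1) k).restrict fun t => X n t y)) μ := fun n k =>
    (continuous_interpPath T k).measurable.comp_aemeasurable
      (aemeasurable_pi_lambda _ fun i => hX n i)
  have hgZ : ∀ k, AEMeasurable
      (fun y => interpPath T k ((grid (⌈T⌉₊ + 1) k).restrict fun t => Z t y)) P := fun k =>
    (continuous_interpPath T k).measurable.comp_aemeasurable
      (aemeasurable_pi_lambda _ fun i => hZ i)
  set D : ℕ → ℝ≥0∞ := fun k => 128 * (1 + (⌈T⌉₊ + 1 : ℕ) * C) * 2⁻¹ ^ k with hDdef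
  have hA : 128 * (1 + (⌈T⌉₊ + 1 : ℕ) * C) ≠ ⊤ :=
    ENNReal.mul_ne_top (by simp) (ENNReal.add_ne_top.2 ⟨by simp, ENNReal.mul_ne_top (by simp) hC⟩)
  have hD : ∀ k, D k ≠ ⊤ := fun k => ENNReal.mul_ne_top hA (by simp)
  have hDlim : Tendsto (fun k => L * (D k).toReal) atTop (𝓝 0) := by
    have : Tendsto D atTop (𝓝 (128 * (1 + (⌈T⌉₊ + 1 : ℕ) * C) * 0)) :=
      ENNReal.Tendsto.const_mul (ENNReal.tendsto_pow_atTop_nhds_zero_of_lt_one (by simp))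
        (Or.inr hA)
    rw [mul_zero] at this
    simpa using ((ENNReal.tendsto_toReal ENNReal.zero_ne_top).comp this).const_mul (L : ℝ)
  have hclose : ∀ n k, |∫ y, F (toPath T fun t => X n t y) ∂μ -
      ∫ y, F (interpPath T k ((grid (⌈T⌉₊ + 1) k).restrict fun t => X n t y)) ∂μ| ≤
      L * (D k).toReal := fun n k =>
    abs_integral_sub_le_of_lipschitz hL hM (hXm n) (hgX n k) (hD k)
      (lintegral_edist_interpPath_le (hX n) (hXc n) T (hinc n) k)
  have hlimk : ∀ k, Tendsto
      (fun n => ∫ y, F (interpPath T k ((grid (⌈T⌉₊ + 1) k).restrict fun t => X n t y)) ∂μ) atTop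
      (𝓝 (∫ ω, F (interpPath T k ((grid (⌈T⌉₊ + 1) k).restrict fun t => Z t ω)) ∂P)) := by
    intro k
    have h := ((hfdd (grid (⌈T⌉₊ + 1) k)).continuous_comp (continuous_interpPath T k)).tendsto
    have h' := tendsto_iff_forall_lipschitz_integral_tendsto.1 h F ⟨M, hM⟩ ⟨L, hL⟩
    have e : ∀ n, ∫ x, F x ∂(μ.map (interpPath T k ∘ fun y =>
        (grid (⌈T⌉₊ + 1) k).restrict fun t => X n t y)) =
        ∫ y, F (interpPath T k ((grid (⌈T⌉₊ + 1) k).restrict fun t => X n t y)) ∂μ := fun n =>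
      integral_map (hgX n k) hL.continuous.aestronglyMeasurable
    rw [← integral_map (hgZ k) hL.continuous.aestronglyMeasurable]
    simp_rw [← e]
    exact h'
  -- For the limit process no increment moments are needed: continuity of paths and dominated
  -- convergence are enough.
  have hlimZ : Tendsto
      (fun k => ∫ ω, F (interpPath T k ((grid (⌈T⌉₊ + 1) k).restrict fun t => Z t ω)) ∂P) atTop
      (𝓝 (∫ ω, F (toPath T fun t => Z t ω) ∂P)) := by
    obtain ⟨ω₀⟩ : Nonempty Ξ := nonempty_of_isProbabilityMeasure P
    refine tendsto_integral_of_dominated_convergence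
      (fun _ => ‖F (toPath T fun t => Z t ω₀)‖ + M)
      (fun k => (hL.continuous.measurable.comp_aemeasurable (hgZ k)).aestronglyMeasurable)
      (integrable_const _) (fun k => Eventually.of_forall fun ω => ?_) ?_
    · have h := hM (interpPath T k ((grid (⌈T⌉₊ + 1) k).restrict fun t => Z t ω))
        (toPath T fun t => Z t ω₀)
      rw [dist_eq_norm] at h
      have h2 := norm_le_norm_add_norm_sub'
        (F (interpPath T k ((grid (⌈T⌉₊ + 1) k).restrict fun t => Z t ω)))
        (F (toPath T fun t => Z t ω₀))
      linarith
    · filter_upwards [hZc] with ω hω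
      exact (hL.continuous.tendsto _).comp (tendsto_interpPath T hω)
  rw [Metric.tendsto_atTop]
  intro ε hε
  -- The grid level $k$ is fixed first, which is possible because the error bound is uniform in $n$;
  -- only then does $n$ tend to infinity.
  obtain ⟨k, hk1, hk2⟩ := ((hDlim.eventually (gt_mem_nhds (by positivity : 0 < ε / 3))).and
    (Metric.tendsto_nhds.1 hlimZ (ε / 3) (by positivity))).exists
  obtain ⟨n₀, hn₀⟩ := Metric.tendsto_atTop.1 (hlimk k) (ε / 3) (by positivity)
  refine ⟨n₀, fun n hn => ?_⟩
  have h1 := hn₀ n hn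
  have h2 := hclose n k
  rw [Real.dist_eq, abs_lt] at h1 hk2
  rw [abs_le] at h2
  rw [Real.dist_eq, abs_lt]
  constructor <;> linarith [h1.1, h1.2, h2.1, h2.2, hk2.1, hk2.2]

end WeakConvergence

/-! ### Increment bounds for the pair -/

section PairIncrements

/-- The sup norm is attained at some coordinate, whose cube is one of the summands. -/
lemma enorm_pow_three_le_sum {ι : Type*} [Fintype ι] {F : Type*} [SeminormedAddCommGroup F]
    (x : ι → F) : ‖x‖ₑ ^ 3 ≤ ∑ i, ‖x i‖ₑ ^ 3 := by
  rcases isEmpty_or_nonempty ι with h | h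
  · rw [Subsingleton.elim x 0]; simp [enorm_eq_nnnorm]
  · obtain ⟨i, -, hi⟩ := Finset.exists_mem_eq_sup Finset.univ Finset.univ_nonempty
      (fun i => ‖x i‖₊)
    have : ‖x‖ₑ = ‖x i‖ₑ := by
      rw [enorm_eq_nnnorm, enorm_eq_nnnorm, Pi.nnnorm_def, hi]
    rw [this]
    exact Finset.single_le_sum (f := fun i => ‖x i‖ₑ ^ 3) (fun _ _ => zero_le) (Finset.mem_univ i)

lemma enorm_pow_three_pair_le {m : ℕ} (x : PairSpace m) :
    ‖x‖ₑ ^ 3 ≤ ∑ i, ‖x.1 i‖ₑ ^ 3 + ∑ i, ∑ j, ‖x.2 i j‖ₑ ^ 3 := by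
  have h2 : ‖x.2‖ₑ ^ 3 ≤ ∑ i, ∑ j, ‖x.2 i j‖ₑ ^ 3 :=
    (enorm_pow_three_le_sum x.2).trans (Finset.sum_le_sum fun i _ => enorm_pow_three_le_sum _)
  have h1 := enorm_pow_three_le_sum x.1
  have hmax : ‖x‖ₑ = max ‖x.1‖ₑ ‖x.2‖ₑ := by
    simp only [enorm_eq_nnnorm, Prod.nnnorm_def, ENNReal.coe_max]
  rcases max_choice ‖x.1‖ₑ ‖x.2‖ₑ with h | h
  · rw [hmax, h]; exact h1.trans le_self_add
  · rw [hmax, h]; exact h2.trans le_add_self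

lemma lintegral_enorm_pow_three_le {α : Type*} [MeasurableSpace α] {μ : Measure α}
    [IsProbabilityMeasure μ] {f : α → ℝ} (hf : Measurable f) {B c : ℝ} (hB : ∀ y, |f y| ≤ B)
    (hc : ∫ y, |f y| ^ 3 ∂μ ≤ c) : ∫⁻ y, ‖f y‖ₑ ^ 3 ∂μ ≤ ENNReal.ofReal c := by
  have hi : Integrable (fun y => |f y| ^ 3) μ :=
    integrable_of_measurable_of_bounded (C := B ^ 3) (hf.norm.pow_const 3) fun y => by
      rw [abs_pow, abs_abs]; gcongr; exact hB y
  have heq : ∀ y, ‖f y‖ₑ ^ 3 = ENNReal.ofReal (|f y| ^ 3) := fun y => by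
    rw [ENNReal.ofReal_pow (abs_nonneg _), Real.enorm_eq_ofReal_abs]
  simp only [heq]
  rw [← ofReal_integral_eq_lintegral_ofReal hi (Eventually.of_forall fun y => by positivity)]
  exact ENNReal.ofReal_le_ofReal hc

lemma lintegral_enorm_pow_three_pair_le {α : Type*} [MeasurableSpace α] {μ : Measure α} {m : ℕ}
    {X : α → PairSpace m} (hX : Measurable X) {a : Fin m → ℝ≥0∞} {b : Fin m → Fin m → ℝ≥0∞}
    {c : ℝ≥0∞} (ha : ∀ i, ∫⁻ y, ‖(X y).1 i‖ₑ ^ 3 ∂μ ≤ a i * c)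
    (hb : ∀ i j, ∫⁻ y, ‖(X y).2 i j‖ₑ ^ 3 ∂μ ≤ b i j * c) :
    ∫⁻ y, ‖X y‖ₑ ^ 3 ∂μ ≤ (∑ i, a i + ∑ i, ∑ j, b i j) * c := by
  have m1 : ∀ i, Measurable fun y => ‖(X y).1 i‖ₑ ^ 3 := fun i => by fun_prop
  have m2 : ∀ i j, Measurable fun y => ‖(X y).2 i j‖ₑ ^ 3 := fun i j => by fun_prop
  calc _ ≤ ∫⁻ y, (∑ i, ‖(X y).1 i‖ₑ ^ 3 + ∑ i, ∑ j, ‖(X y).2 i j‖ₑ ^ 3) ∂μ :=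
        lintegral_mono fun y => enorm_pow_three_pair_le _
    _ = ∑ i, ∫⁻ y, ‖(X y).1 i‖ₑ ^ 3 ∂μ + ∑ i, ∑ j, ∫⁻ y, ‖(X y).2 i j‖ₑ ^ 3 ∂μ := by
      rw [lintegral_add_left (Finset.measurable_fun_sum _ fun i _ => m1 i),
        lintegral_finsetSum _ fun i _ => m1 i,
        lintegral_finsetSum _ fun i _ => Finset.measurable_fun_sum _ fun j _ => m2 i j]
      congr 1
      exact Finset.sum_congr rfl fun i _ => lintegral_finsetSum _ fun j _ => m2 i j
    _ ≤ _ := by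
      rw [add_mul, Finset.sum_mul, Finset.sum_mul]
      simp only [Finset.sum_mul]
      gcongr with i _ i _ j _
      · exact ha i
      · exact hb i j

variable {Ω : Type u} [MetricSpace Ω] {φ : Flow ℝ Ω}

lemma continuous_scaledPair {m : ℕ} {v : Fin m → Ω → ℝ} (hv : ∀ i, Continuous (v i)) (n : ℕ) :
    Continuous fun p : ℝ≥0 × Ω => scaledPair φ v n p.1 p.2 := by
  have hc : Continuous fun p : ℝ≥0 × Ω => ((p.1 : ℝ) * n, p.2) := by fun_prop
  unfold scaledPair scaledW scaledWW
  refine Continuous.prodMk (continuous_pi fun i => ?_)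
    (continuous_pi fun i => continuous_pi fun j => ?_)
  · exact ((continuous_flowIntegral φ (hv i)).comp hc).const_mul _
  · exact ((continuous_iteratedIntegral φ (hv i) (hv j)).comp hc).const_mul _

/-- Integration by parts is compatible with the scaling because $(n^{-1/2})^2=n^{-1}$. Written in
the coordinates of the pair it is a closed condition, ready to pass to the limit. -/
lemma scaledPair_fst_mul_fst {v : Fin m → Ω → ℝ} (hv : ∀ i, Continuous (v i)) (n : ℕ) (t : ℝ≥0)
    (y : Ω) (i j : Fin m) :
    (scaledPair φ v n t y).1 i * (scaledPair φ v n t y).1 j =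
      (scaledPair φ v n t y).2 i j + (scaledPair φ v n t y).2 j i := by
  simp only [scaledPair, scaledW, scaledWW]
  rw [mul_mul_mul_comm, flowIntegral_mul_flowIntegral φ (hv i) (hv j), ← mul_inv,
    Real.mul_self_sqrt n.cast_nonneg, mul_add]

variable [MeasurableSpace Ω] [BorelSpace Ω]

lemma measurable_scaledPair {m : ℕ} {v : Fin m → Ω → ℝ} (hv : ∀ i, Continuous (v i)) (n : ℕ)
    (t : ℝ≥0) : Measurable (scaledPair φ v n t) :=
  ((continuous_scaledPair hv n).comp (Continuous.prodMk_right t)).measurable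

variable {μ : Measure Ω} [IsProbabilityMeasure μ] {κ : ℝ≥0}

/-- Third moments of the increments of `(W_{v,n}, 𝕎_{v,n})`, uniformly in `n`. -/
lemma exists_scaledPair_increment_bound (hμ : IsErgodicFlow φ μ) (hmom : MomentBounds φ κ μ)
    {m : ℕ} (v : Fin m → HolderZero κ μ) (N : ℕ) :
    ∃ C : ℝ≥0∞, C ≠ ⊤ ∧ ∀ (n : ℕ) (s h : ℝ≥0), s + h ≤ N →
      ∫⁻ y, ‖scaledPair φ (fun i => (v i : Ω → ℝ)) n (s + h) y -
        scaledPair φ (fun i => (v i : Ω → ℝ)) n s y‖ₑ ^ 3 ∂μ ≤ C * ENNReal.ofReal (√h ^ 3) := by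
  choose A hA0 hA using fun i => exists_scaledW_increment_bound hμ hmom (v i)
  choose B hB0 hB using fun i j => exists_scaledWW_increment_bound hμ hmom (v i) (v j) N
  choose D hD using fun i => (v i).2.2.1
  refine ⟨∑ i, ENNReal.ofReal (A i) + ∑ i, ∑ j, ENNReal.ofReal (B i j), by
    simp [ENNReal.sum_eq_top], fun n s h hsh => ?_⟩
  have hmW : ∀ i (t : ℝ≥0), Measurable fun y =>
      (√n)⁻¹ * flowIntegral φ (v i) (t * n) y := fun i t =>
    (measurable_flowIntegral (v i).2.1 _).const_mul _
  have hmWW : ∀ i j (t : ℝ≥0), Measurable fun y =>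
      (n : ℝ)⁻¹ * iteratedIntegral φ (v i) (v j) (t * n) y := fun i j t =>
    (measurable_iteratedIntegral (v i).2.1 (v j).2.1 _).const_mul _
  have hW : ∀ i, ∫⁻ y, ‖(√n)⁻¹ * flowIntegral φ (v i) ((s + h : ℝ≥0) * n) y -
      (√n)⁻¹ * flowIntegral φ (v i) (s * n) y‖ₑ ^ 3 ∂μ ≤
      ENNReal.ofReal (A i) * ENNReal.ofReal (√h ^ 3) := fun i => by
    rw [← ENNReal.ofReal_mul (hA0 i)]
    refine lintegral_enorm_pow_three_le ((hmW i _).sub (hmW i _))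
      (B := |(√n)⁻¹| * (D i * |((s + h : ℝ≥0) : ℝ) * n|) + |(√n)⁻¹| * (D i * |(s : ℝ) * n|))
      (fun y => ?_) (hA i n s h)
    refine (abs_sub _ _).trans ?_
    rw [abs_mul, abs_mul]
    gcongr <;> exact abs_flowIntegral_le φ (hD i) _ _
  have hWW : ∀ i j, ∫⁻ y, ‖(n : ℝ)⁻¹ * iteratedIntegral φ (v i) (v j) ((s + h : ℝ≥0) * n) y -
      (n : ℝ)⁻¹ * iteratedIntegral φ (v i) (v j) (s * n) y‖ₑ ^ 3 ∂μ ≤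
      ENNReal.ofReal (B i j) * ENNReal.ofReal (√h ^ 3) := fun i j => by
    rw [← ENNReal.ofReal_mul (hB0 i j)]
    refine lintegral_enorm_pow_three_le ((hmWW i j _).sub (hmWW i j _))
      (B := |(n : ℝ)⁻¹| * (D i * D j * |((s + h : ℝ≥0) : ℝ) * n| ^ 2) +
        |(n : ℝ)⁻¹| * (D i * D j * |(s : ℝ) * n| ^ 2))
      (fun y => ?_) (hB i j n s h hsh)
    refine (abs_sub _ _).trans ?_
    rw [abs_mul, abs_mul]
    gcongr <;> exact abs_iteratedIntegral_le φ (hD i) (hD j) _ _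
  exact lintegral_enorm_pow_three_pair_le
    ((measurable_scaledPair (fun i => (v i).2.1) n _).sub
      (measurable_scaledPair (fun i => (v i).2.1) n _)) hW hWW

end PairIncrements

/-! ### Regularity of limit pairs and weak convergence to them -/

section LimitPair

variable {Ω : Type u} [MetricSpace Ω] [MeasurableSpace Ω] [BorelSpace Ω] {φ : Flow ℝ Ω}
  {μ : Measure Ω} [IsProbabilityMeasure μ] {κ : ℝ≥0}
  {𝔅 : HolderZero κ μ →ₗ[ℝ] HolderZero κ μ →ₗ[ℝ] ℝ} {m : ℕ} {v : Fin m → HolderZero κ μ}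
  {Ξ : Type w} [mΞ : MeasurableSpace Ξ] {𝓕 : Filtration ℝ≥0 mΞ} {P : Measure Ξ}
  [IsProbabilityMeasure P] {W : ℝ≥0 → Ξ → Fin m → ℝ} {WW : ℝ≥0 → Ξ → Fin m → Fin m → ℝ}

/-- Convergence in distribution of the marginal at $t$ includes measurability of its limit. -/
lemma IsLimitPair.aemeasurable (h : IsLimitPair φ μ 𝔅 v 𝓕 P W WW) (t : ℝ≥0) :
    AEMeasurable (fun ω => (W t ω, WW t ω)) P :=
  (measurable_pi_apply (⟨t, Finset.mem_singleton_self t⟩ : ({t} : Finset ℝ≥0))).comp_aemeasurable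
    (h.tendsto {t}).aemeasurable_limit

lemma IsLimitPair.ae_continuous (h : IsLimitPair φ μ 𝔅 v 𝓕 P W WW) :
    ∀ᵐ ω ∂P, Continuous fun t => (W t ω, WW t ω) := by
  have hI : ∀ᵐ ω ∂P, ∀ i j, Continuous fun t : ℝ≥0 => WW t ω i j - 𝔅 (v i) (v j) * t :=
    ae_all_iff.2 fun i => ae_all_iff.2 fun j => (h.ito i j).continuous
  filter_upwards [h.brownian.continuous, hI] with ω hω hω'
  refine hω.prodMk (continuous_pi fun i => continuous_pi fun j => ?_)
  have h2 : Continuous fun t : ℝ≥0 => 𝔅 (v i) (v j) * (t : ℝ) := by fun_prop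
  have h3 := (hω' i j).add h2
  simp only [Pi.add_def, sub_add_cancel] at h3
  exact h3

/-- Convergence of the finite-dimensional distributions of `(W_{v,n}, 𝕎_{v,n})` improves to weak
convergence in the supremum norm. -/
theorem IsLimitPair.tendstoWeaklySup (hμ : IsErgodicFlow φ μ) (hmom : MomentBounds φ κ μ)
    (h : IsLimitPair φ μ 𝔅 v 𝓕 P W WW) :
    TendstoWeaklySup (scaledPair φ fun i => (v i : Ω → ℝ)) μ (fun t ω => (W t ω, WW t ω)) P :=
  h.tendsto.tendstoWeaklySup
    (fun n t => (measurable_scaledPair (fun i => (v i).2.1) n t).aemeasurable)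
    (fun n => Eventually.of_forall fun y =>
      (continuous_scaledPair (fun i => (v i).2.1) n).comp (Continuous.prodMk_left y))
    h.aemeasurable h.ae_continuous (exists_scaledPair_increment_bound hμ hmom v)

end LimitPair

/-! ### Itô integrals have mean zero -/

section Ito

variable {Ξ : Type w} [mΞ : MeasurableSpace Ξ] {𝓕 : Filtration ℝ≥0 mΞ} {P : Measure Ξ} {m : ℕ}
  {W : ℝ≥0 → Ξ → Fin m → ℝ}

lemma IsBrownianMotion.integral_increment (hW : IsBrownianMotion 𝓕 P W) {s t : ℝ≥0} (hst : s ≤ t)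
    (j : Fin m) : Integrable (fun ω => W t ω j - W s ω j) P ∧
      ∫ ω, (W t ω j - W s ω j) ∂P = 0 := by
  obtain ⟨S, -, hS⟩ := hW.gaussian
  have hlaw := hS s t hst
  set ν : Measure (EuclideanSpace ℝ (Fin m)) :=
    multivariateGaussian 0 (((t : ℝ) - (s : ℝ)) • S) with hν
  have hi : Integrable (fun x : EuclideanSpace ℝ (Fin m) => x) ν :=
    IsGaussian.integrable_id (μ := ν)
  have hij : Integrable (fun x : EuclideanSpace ℝ (Fin m) => x j) ν :=
    (EuclideanSpace.proj (𝕜 := ℝ) j).integrable_comp hi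
  have h0 : ∫ x, x j ∂ν = 0 := by
    have := (EuclideanSpace.proj (𝕜 := ℝ) j).integral_comp_comm hi
    rw [hν, integral_id_multivariateGaussian] at this
    simpa using this
  rw [← hlaw.map_eq] at hij h0
  refine ⟨hij.comp_aemeasurable hlaw.aemeasurable, ?_⟩
  rw [integral_map hlaw.aemeasurable hij.aestronglyMeasurable] at h0
  exact h0

/-- Each coefficient is measurable at the left end of its interval, hence independent of the
following centred increment, and the expectation factorises. -/
lemma SimpleProcess.integral_integral [IsProbabilityMeasure P] (hW : IsBrownianMotion 𝓕 P W)
    (H : SimpleProcess 𝓕) (j : Fin m) (t : ℝ≥0) :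
    Integrable (fun ω => H.integral (fun t ω => W t ω j) t ω) P ∧
      ∫ ω, H.integral (fun t ω => W t ω j) t ω ∂P = 0 := by
  have key : ∀ k, Integrable (fun ω => H.val k ω *
      (W (min t (H.time k.succ)) ω j - W (min t (H.time k.castSucc)) ω j)) P ∧
      ∫ ω, H.val k ω * (W (min t (H.time k.succ)) ω j - W (min t (H.time k.castSucc)) ω j) ∂P
        = 0 := by
    intro k
    have hk : H.time k.castSucc ≤ H.time k.succ := H.mono (Fin.castSucc_le_succ k)
    -- If the interval starts after $t$, both of its ends are truncated to $t$ and the term is zero.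
    rcases le_total t (H.time k.castSucc) with ht | ht
    · simp [min_eq_left ht, min_eq_left (ht.trans hk)]
    · rw [min_eq_right ht]
      have hle : H.time k.castSucc ≤ min t (H.time k.succ) := le_min ht hk
      obtain ⟨hi, h0⟩ := hW.integral_increment hle j
      have hval : Measurable (H.val k) := (H.adapted k).mono (𝓕.le _) le_rfl
      obtain ⟨C, hC⟩ := H.bounded k
      have hvi : Integrable (H.val k) P := integrable_of_measurable_of_bounded hval hC
      have hind : IndepFun (H.val k)
          (fun ω => W (min t (H.time k.succ)) ω j - W (H.time k.castSucc) ω j) P := by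
        rw [IndepFun_iff_Indep]
        refine indep_of_indep_of_le_left (indep_of_indep_of_le_right (hW.indep _ _ hle) ?_)
          (H.adapted k).comap_le
        rintro _ ⟨A, hA, rfl⟩
        exact ⟨(fun x => x j) ⁻¹' A, measurable_pi_apply j hA, rfl⟩
      refine ⟨hind.integrable_mul hvi hi, ?_⟩
      rw [hind.integral_fun_mul_eq_mul_integral hvi.aestronglyMeasurable hi.aestronglyMeasurable,
        h0, mul_zero]
  unfold SimpleProcess.integral
  refine ⟨integrable_finsetSum _ fun k _ => (key k).1, ?_⟩
  rw [integral_finsetSum _ fun k _ => (key k).1]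
  exact Finset.sum_eq_zero fun k _ => (key k).2

/-- Itô integrals against Brownian motion are centred. -/
lemma IsItoIntegral.integral_eq_zero [IsProbabilityMeasure P] (hW : IsBrownianMotion 𝓕 P W)
    {H I : ℝ≥0 → Ξ → ℝ} {j : Fin m} (hI : IsItoIntegral 𝓕 P H (fun t ω => W t ω j) I) (t : ℝ≥0) :
    ∫ ω, I t ω ∂P = 0 := by
  obtain ⟨A, -, hA⟩ := hI.approx t
  have hIi : Integrable (I t) P := (hI.memLp t).integrable (by norm_num)
  have hAi := fun n => (A n).integral_integral hW j t
  -- On a probability space $L^2$ convergence implies $L^1$ convergence, so the means converge.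
  have hlim := tendsto_integral_of_L1' (I t) hIi.aestronglyMeasurable
    (F := fun n ω => (A n).integral (fun t ω => W t ω j) t ω) (l := atTop)
    (Eventually.of_forall fun n => (hAi n).1)
    (tendsto_of_tendsto_of_tendsto_of_le_of_le tendsto_const_nhds hA (fun _ => zero_le) fun n =>
      eLpNorm_le_eLpNorm_of_exponent_le (by norm_num)
        ((hAi n).1.sub hIi).aestronglyMeasurable)
  simp only [(hAi _).2] at hlim
  exact tendsto_nhds_unique hlim tendsto_const_nhds

end Ito

/-! ### Covariance of the limit and positivity of $\mathfrak B$ -/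

section Covariance

variable {Ω : Type u} [MetricSpace Ω] [MeasurableSpace Ω] [BorelSpace Ω] {φ : Flow ℝ Ω}
  {μ : Measure Ω} [IsProbabilityMeasure μ] {κ : ℝ≥0}
  {𝔅 : HolderZero κ μ →ₗ[ℝ] HolderZero κ μ →ₗ[ℝ] ℝ} {m : ℕ} {v : Fin m → HolderZero κ μ}
  {Ξ : Type w} [mΞ : MeasurableSpace Ξ] {𝓕 : Filtration ℝ≥0 mΞ} {P : Measure Ξ}
  [IsProbabilityMeasure P] {W : ℝ≥0 → Ξ → Fin m → ℝ} {WW : ℝ≥0 → Ξ → Fin m → Fin m → ℝ}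

/-- The limit pair inherits the integration by parts formula of its smooth approximations. -/
lemma IsLimitPair.mul_eq_add (h : IsLimitPair φ μ 𝔅 v 𝓕 P W WW) (t : ℝ≥0) (i j : Fin m) :
    ∀ᵐ ω ∂P, W t ω i * W t ω j = WW t ω i j + WW t ω j i := by
  let τ : ({t} : Finset ℝ≥0) := ⟨t, Finset.mem_singleton_self t⟩
  let g : (({t} : Finset ℝ≥0) → PairSpace m) → ℝ := fun x =>
    (x τ).1 i * (x τ).1 j - ((x τ).2 i j + (x τ).2 j i)
  have hg : Continuous g := by fun_prop
  have h1 := (h.tendsto {t}).continuous_comp hg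
  have h0 : ∀ n, (g ∘ fun y => ({t} : Finset ℝ≥0).restrict fun t =>
      scaledPair φ (fun i => (v i : Ω → ℝ)) n t y) = fun _ => (0 : ℝ) := fun n => by
    ext y
    exact sub_eq_zero.2 (scaledPair_fst_mul_fst (fun i => (v i).2.1) n t y i j)
  simp only [h0] at h1
  -- The integration by parts defect `g` vanishes identically before the limit, so by uniqueness of
  -- limits in law its limiting law is the point mass at $0$.
  have h2 : TendstoInDistribution (fun (_ : ℕ) (_ : Ω) => (0 : ℝ)) atTop (fun _ : Ω => (0 : ℝ))
      (fun _ => μ) μ := tendstoInDistribution_const aemeasurable_const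
  have h3 := tendstoInDistribution_unique _ h1 h2
  have h4 : ∀ᵐ x ∂(P.map (g ∘ fun ω => ({t} : Finset ℝ≥0).restrict fun t => (W t ω, WW t ω))),
      x = 0 := by
    rw [h3, Measure.map_const]
    simp
  filter_upwards [ae_of_ae_map h1.aemeasurable_limit h4] with ω hω
  exact sub_eq_zero.1 hω

lemma IsLimitPair.integral_snd (h : IsLimitPair φ μ 𝔅 v 𝓕 P W WW) (t : ℝ≥0) (i j : Fin m) :
    Integrable (fun ω => WW t ω i j) P ∧ ∫ ω, WW t ω i j ∂P = 𝔅 (v i) (v j) * t := by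
  have hI := ((h.ito i j).memLp t).integrable (by norm_num)
  have h0 := (h.ito i j).integral_eq_zero h.brownian t
  have hi : Integrable (fun ω => WW t ω i j) P := by
    have := hI.add (integrable_const (𝔅 (v i) (v j) * (t : ℝ)))
    simpa [Pi.add_def] using this
  refine ⟨hi, ?_⟩
  rw [integral_sub hi (integrable_const _)] at h0
  simpa [sub_eq_zero] using h0

/-- The covariance of the limiting Brownian motion. -/
theorem IsLimitPair.covariance (h : IsLimitPair φ μ 𝔅 v 𝓕 P W WW) (i j : Fin m) :
    Integrable (fun ω => W 1 ω i * W 1 ω j) P ∧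
      ∫ ω, W 1 ω i * W 1 ω j ∂P = 𝔅 (v i) (v j) + 𝔅 (v j) (v i) := by
  obtain ⟨i1, e1⟩ := h.integral_snd 1 i j
  obtain ⟨i2, e2⟩ := h.integral_snd 1 j i
  have hae := h.mul_eq_add 1 i j
  refine ⟨(i1.add i2).congr (hae.mono fun ω hω => hω.symm), ?_⟩
  rw [integral_congr_ae hae, integral_add i1 i2, e1, e2]
  simp

lemma IteratedCLT.apply_self_nonneg (hclt : IteratedCLT.{u, w} φ μ 𝔅) (v : HolderZero κ μ) :
    0 ≤ 𝔅 v v := by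
  obtain ⟨Ξ, mΞ, 𝓕, P, hP, W, WW, h⟩ := hclt 1 fun _ => v
  have h1 := (h.covariance 0 0).2
  have h2 : 0 ≤ ∫ ω, W 1 ω 0 * W 1 ω 0 ∂P := integral_nonneg fun ω => mul_self_nonneg _
  linarith

end Covariance

/-! ### The Banach space of mean zero Hölder functions -/

section HolderNorm

variable {Ω : Type u} [MetricSpace Ω] {κ : ℝ≥0}

lemma holderNorm_nonneg (v : Ω → ℝ) : 0 ≤ holderNorm κ v :=
  add_nonneg (Real.iSup_nonneg fun _ => abs_nonneg _) (NNReal.coe_nonneg _)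

lemma holderNorm_le [Nonempty Ω] {v : Ω → ℝ} {A : ℝ} {B : ℝ≥0} (hA : ∀ y, |v y| ≤ A)
    (hB : HolderWith B κ v) : holderNorm κ v ≤ A + B :=
  add_le_add (ciSup_le hA) (NNReal.coe_le_coe.2 hB.nnholderNorm_le)

lemma holderWith_of_abs_sub_le {f : Ω → ℝ} {B : ℝ≥0}
    (h : ∀ x y, |f x - f y| ≤ B * dist x y ^ (κ : ℝ)) : HolderWith B κ f := fun x y => by
  rw [edist_dist, edist_dist, Real.dist_eq,
    ENNReal.ofReal_rpow_of_nonneg dist_nonneg κ.coe_nonneg, ← ENNReal.ofReal_coe_nnreal, ← ENNReal.ofReal_mul B.coe_nonneg]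
  exact ENNReal.ofReal_le_ofReal (h x y)

end HolderNorm

section HolderSpace

variable {Ω : Type u} [MetricSpace Ω] [MeasurableSpace Ω] [BorelSpace Ω] {μ : Measure Ω}
  [IsProbabilityMeasure μ] {κ : ℝ≥0}

lemma HolderZero.abs_apply_le (v : HolderZero κ μ) (y : Ω) :
    |(v : Ω → ℝ) y| ≤ holderNorm κ (v : Ω → ℝ) := by
  obtain ⟨C, hC⟩ := v.2.2.1
  have h1 : |(v : Ω → ℝ) y| ≤ ⨆ y, |(v : Ω → ℝ) y| :=
    le_ciSup (f := fun y => |(v : Ω → ℝ) y|) ⟨C, by rintro _ ⟨y, rfl⟩; exact hC y⟩ y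
  have h2 : (0 : ℝ) ≤ nnHolderNorm κ (v : Ω → ℝ) := NNReal.coe_nonneg _
  unfold holderNorm
  linarith

lemma HolderZero.holderNorm_add_le (v w : HolderZero κ μ) :
    holderNorm κ ((v + w : HolderZero κ μ) : Ω → ℝ) ≤
      holderNorm κ (v : Ω → ℝ) + holderNorm κ (w : Ω → ℝ) := by
  have : Nonempty Ω := nonempty_of_isProbabilityMeasure μ
  obtain ⟨C, hC⟩ := v.2.2.1
  obtain ⟨D, hD⟩ := w.2.2.1
  have h := MemHolder.nnHolderNorm_add_le v.2.2.2.1 w.2.2.2.1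
  have h' : (nnHolderNorm κ ((v : Ω → ℝ) + (w : Ω → ℝ)) : ℝ) ≤
      nnHolderNorm κ (v : Ω → ℝ) + nnHolderNorm κ (w : Ω → ℝ) := by exact_mod_cast h
  have hs : ⨆ y, |((v : Ω → ℝ) + (w : Ω → ℝ)) y| ≤ (⨆ y, |(v : Ω → ℝ) y|) + ⨆ y, |(w : Ω → ℝ) y| :=
    ciSup_le fun y => (abs_add_le _ _).trans (add_le_add
      (le_ciSup (f := fun y => |(v : Ω → ℝ) y|) ⟨C, by rintro _ ⟨y, rfl⟩; exact hC y⟩ y)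
      (le_ciSup (f := fun y => |(w : Ω → ℝ) y|) ⟨D, by rintro _ ⟨y, rfl⟩; exact hD y⟩ y))
  change holderNorm κ ((v : Ω → ℝ) + (w : Ω → ℝ)) ≤ _
  unfold holderNorm
  linarith

lemma HolderZero.holderNorm_smul (c : ℝ) (v : HolderZero κ μ) :
    holderNorm κ ((c • v : HolderZero κ μ) : Ω → ℝ) = |c| * holderNorm κ (v : Ω → ℝ) := by
  change holderNorm κ (c • (v : Ω → ℝ)) = _
  unfold holderNorm
  rw [MemHolder.nnHolderNorm_smul v.2.2.2.1, mul_add, Real.mul_iSup_of_nonneg (abs_nonneg c)]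
  simp [abs_mul]

lemma HolderZero.holderNorm_neg (v : HolderZero κ μ) :
    holderNorm κ ((-v : HolderZero κ μ) : Ω → ℝ) = holderNorm κ (v : Ω → ℝ) := by
  rw [← neg_one_smul ℝ v, HolderZero.holderNorm_smul, abs_neg, abs_one, one_mul]

/-- The space `C₀^κ(Ω)` as a normed space. -/
def HolderSpace (κ : ℝ≥0) (μ : Measure Ω) [IsProbabilityMeasure μ] : Type u := HolderZero κ μ

instance : AddCommGroup (HolderSpace κ μ) := inferInstanceAs (AddCommGroup (HolderZero κ μ))

instance : Module ℝ (HolderSpace κ μ) := inferInstanceAs (Module ℝ (HolderZero κ μ))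

/-- The function underlying an element of `C₀^κ(Ω)`. -/
def HolderSpace.toFun (v : HolderSpace κ μ) : Ω → ℝ := (show HolderZero κ μ from v : Ω → ℝ)

lemma HolderSpace.mem (v : HolderSpace κ μ) : v.toFun ∈ HolderZero κ μ :=
  (show HolderZero κ μ from v).2

/-- As a submodule of `Ω → ℝ`, `HolderZero` already carries the topology of pointwise convergence;
the synonym leaves room for the Hölder norm. -/
instance : NormedAddCommGroup (HolderSpace κ μ) :=
  AddGroupNorm.toNormedAddCommGroup
    { toFun := fun v => holderNorm κ v.toFun
      map_zero' := by
        have := HolderZero.holderNorm_smul 0 (0 : HolderZero κ μ)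
        rw [zero_smul, abs_zero, zero_mul] at this
        exact this
      add_le' := HolderZero.holderNorm_add_le
      neg' := HolderZero.holderNorm_neg
      eq_zero_of_map_eq_zero' := fun v hv => Subtype.ext (funext fun y => abs_eq_zero.1
        (le_antisymm ((HolderZero.abs_apply_le (show HolderZero κ μ from v) y).trans hv.le)
          (abs_nonneg _))) }

instance : NormedSpace ℝ (HolderSpace κ μ) where
  norm_smul_le c v := (HolderZero.holderNorm_smul c (show HolderZero κ μ from v)).le

lemma HolderSpace.abs_toFun_le (v : HolderSpace κ μ) (y : Ω) : |v.toFun y| ≤ ‖v‖ :=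
  HolderZero.abs_apply_le (show HolderZero κ μ from v) y

lemma HolderSpace.abs_toFun_sub_le (v : HolderSpace κ μ) (x y : Ω) :
    |v.toFun x - v.toFun y| ≤ ‖v‖ * dist x y ^ (κ : ℝ) := by
  have h := v.mem.2.2.1.holderWith.dist_le x y
  rw [Real.dist_eq] at h
  refine h.trans ?_
  gcongr
  exact le_add_of_nonneg_left (Real.iSup_nonneg fun _ => abs_nonneg _)

/-- The space `C₀^κ(Ω)` is complete. -/
lemma HolderSpace.completeSpace (hκ : 0 < κ) : CompleteSpace (HolderSpace κ μ) := by
  have : Nonempty Ω := nonempty_of_isProbabilityMeasure μ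
  refine Metric.complete_of_cauchySeq_tendsto fun u hu => ?_
  have hcau : ∀ y, CauchySeq fun n => (u n).toFun y := fun y => by
    rw [Metric.cauchySeq_iff] at hu ⊢
    intro ε hε
    obtain ⟨N, hN⟩ := hu ε hε
    refine ⟨N, fun p hp q hq => lt_of_le_of_lt ?_ (hN p hp q hq)⟩
    rw [Real.dist_eq, dist_eq_norm]
    exact (u p - u q).abs_toFun_le y
  choose f hf using fun y => cauchySeq_tendsto_of_complete (hcau y)
  -- The Cauchy estimates for $u_n-u_p$ hold pointwise and for pairs of points, so they pass to the
  -- pointwise limit $p\to\infty$.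
  have hclose : ∀ ε : ℝ≥0, 0 < ε → ∃ N, ∀ n ≥ N, (∀ y, |(u n).toFun y - f y| ≤ ε) ∧
      HolderWith ε κ ((u n).toFun - f) := by
    intro ε hε
    obtain ⟨N, hN⟩ := Metric.cauchySeq_iff.1 hu ε hε
    refine ⟨N, fun n hn => ⟨fun y => ?_, holderWith_of_abs_sub_le fun x y => ?_⟩⟩
    · refine le_of_tendsto (((tendsto_const_nhds (x := (u n).toFun y)).sub (hf y)).abs)
        (eventually_atTop.2 ⟨N, fun p hp => ?_⟩)
      refine ((u n - u p).abs_toFun_le y).trans ?_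
      rw [← dist_eq_norm]
      exact (hN n hn p hp).le
    · refine le_of_tendsto ((((tendsto_const_nhds (x := (u n).toFun x)).sub (hf x)).sub
        ((tendsto_const_nhds (x := (u n).toFun y)).sub (hf y))).abs)
        (eventually_atTop.2 ⟨N, fun p hp => ?_⟩)
      refine ((u n - u p).abs_toFun_sub_le x y).trans ?_
      rw [← dist_eq_norm]
      gcongr
      exact (hN n hn p hp).le
  have hmem : f ∈ HolderZero κ μ := by
    obtain ⟨N, hN⟩ := hclose 1 one_pos
    obtain ⟨hb, hh⟩ := hN N le_rfl
    have hholder : MemHolder κ f := by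
      have h := (u N).mem.2.2.1.add (hh.memHolder.smul (𝕜 := ℝ) (c := -1))
      have e : (u N).toFun + (-1 : ℝ) • ((u N).toFun - f) = f := by ext; simp
      rwa [e] at h
    have hcont : Continuous f := by
      obtain ⟨C, hC⟩ := hholder
      exact hC.continuous hκ
    obtain ⟨C, hC⟩ := (u N).mem.2.1
    have hbd : ∀ y, |f y| ≤ C + 1 := fun y => by
      have h1 := hb y
      have h2 := hC y
      rw [NNReal.coe_one] at h1
      rw [abs_le] at h1 h2 ⊢
      constructor <;> linarith
    refine ⟨hcont, ⟨_, hbd⟩, hholder, ?_⟩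
    -- The mean of $f$ vanishes because $|\int f|=|\int(u_M-f)|\le\varepsilon$ for every
    -- $\varepsilon>0$ and suitable $M$.
    refine abs_eq_zero.1 (le_antisymm (le_of_forall_pos_le_add fun ε hε => ?_) (abs_nonneg _))
    obtain ⟨M, hM⟩ := hclose ⟨ε, hε.le⟩ hε
    have hb' := (hM M le_rfl).1
    have iu : Integrable (u M).toFun μ := integrable_of_measurable_of_bounded
      (u M).mem.1.measurable (u M).abs_toFun_le
    have iF : Integrable f μ := integrable_of_measurable_of_bounded hcont.measurable hbd
    have h := norm_integral_le_of_norm_le_const (μ := μ) (f := fun y => (u M).toFun y - f y)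
      (C := ε) (Eventually.of_forall hb')
    rw [integral_sub iu iF, (u M).mem.2.2.2, zero_sub, norm_neg] at h
    simpa using h
  let F : HolderSpace κ μ := (⟨f, hmem⟩ : HolderZero κ μ)
  refine ⟨F, Metric.tendsto_atTop.2 fun ε hε => ?_⟩
  lift ε to ℝ≥0 using hε.le
  have hε' : 0 < ε := by exact_mod_cast hε
  obtain ⟨N, hN⟩ := hclose (ε / 3) (by positivity)
  refine ⟨N, fun n hn => ?_⟩
  obtain ⟨hb, hh⟩ := hN n hn
  rw [dist_eq_norm]
  have h : ‖u n - F‖ ≤ (ε / 3 : ℝ≥0) + (ε / 3 : ℝ≥0) := holderNorm_le (v := (u n).toFun - f) hb hh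
  push_cast at h
  have := NNReal.coe_pos.2 hε'
  linarith

end HolderSpace

/-- The uniform boundedness principle for bilinear maps. -/
lemma exists_bound_of_pointwise_bound {E F G ι : Type*} [NormedAddCommGroup E] [NormedSpace ℝ E]
    [CompleteSpace E] [NormedAddCommGroup F] [NormedSpace ℝ F] [CompleteSpace F]
    [NormedAddCommGroup G] [NormedSpace ℝ G] (T : ι → E →L[ℝ] F →L[ℝ] G)
    (h : ∀ x y, ∃ C, ∀ i, ‖T i x y‖ ≤ C) : ∃ C, ∀ i x y, ‖T i x y‖ ≤ C * ‖x‖ * ‖y‖ := by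
  -- The inner application works on `F` with `x` fixed; its bound on `‖T i x‖` is the pointwise
  -- hypothesis of the outer one on `E`.
  obtain ⟨C, hC⟩ := banach_steinhaus (g := T) fun x => banach_steinhaus (h x)
  refine ⟨C, fun i x y => ((T i).le_opNorm₂ x y).trans ?_⟩
  gcongr
  exact hC i

/-! ### Boundedness of $\mathfrak B$ by uniform boundedness and Fatou -/

section Boundedness

variable {Ω : Type u} [MetricSpace Ω] {φ : Flow ℝ Ω}

lemma flowIntegral_add_left {v v' : Ω → ℝ} (hv : Continuous v) (hv' : Continuous v') (t : ℝ)
    (y : Ω) : flowIntegral φ (v + v') t y = flowIntegral φ v t y + flowIntegral φ v' t y := by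
  have hc : ∀ {v : Ω → ℝ}, Continuous v → Continuous fun r => v (φ r y) := fun hv =>
    (continuous_observable_flow φ hv).comp (continuous_id.prodMk continuous_const)
  exact intervalIntegral.integral_add ((hc hv).intervalIntegrable _ _)
    ((hc hv').intervalIntegrable _ _)

lemma flowIntegral_smul (c : ℝ) (v : Ω → ℝ) (t : ℝ) (y : Ω) :
    flowIntegral φ (c • v) t y = c * flowIntegral φ v t y := by
  simp [flowIntegral]

lemma continuous_flowIntegral_mul_apply {v w : Ω → ℝ} (hv : Continuous v) (hw : Continuous w)
    (y : Ω) : Continuous fun s => flowIntegral φ v s y * w (φ s y) :=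
  (continuous_flowIntegral_mul φ hv hw).comp (continuous_id.prodMk continuous_const)

lemma iteratedIntegral_add_left {v v' w : Ω → ℝ} (hv : Continuous v) (hv' : Continuous v')
    (hw : Continuous w) (t : ℝ) (y : Ω) : iteratedIntegral φ (v + v') w t y =
      iteratedIntegral φ v w t y + iteratedIntegral φ v' w t y := by
  simp only [iteratedIntegral_eq, flowIntegral_add_left hv hv', add_mul]
  exact intervalIntegral.integral_add
    ((continuous_flowIntegral_mul_apply hv hw y).intervalIntegrable _ _)
    ((continuous_flowIntegral_mul_apply hv' hw y).intervalIntegrable _ _)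

lemma iteratedIntegral_add_right {v w w' : Ω → ℝ} (hv : Continuous v) (hw : Continuous w)
    (hw' : Continuous w') (t : ℝ) (y : Ω) : iteratedIntegral φ v (w + w') t y =
      iteratedIntegral φ v w t y + iteratedIntegral φ v w' t y := by
  simp only [iteratedIntegral_eq, Pi.add_apply, mul_add]
  exact intervalIntegral.integral_add
    ((continuous_flowIntegral_mul_apply hv hw y).intervalIntegrable _ _)
    ((continuous_flowIntegral_mul_apply hv hw' y).intervalIntegrable _ _)

lemma iteratedIntegral_smul_left (c : ℝ) (v w : Ω → ℝ) (t : ℝ) (y : Ω) :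
    iteratedIntegral φ (c • v) w t y = c * iteratedIntegral φ v w t y := by
  simp only [iteratedIntegral_eq, flowIntegral_smul, mul_assoc, intervalIntegral.integral_const_mul]

lemma iteratedIntegral_smul_right (c : ℝ) (v w : Ω → ℝ) (t : ℝ) (y : Ω) :
    iteratedIntegral φ v (c • w) t y = c * iteratedIntegral φ v w t y := by
  simp only [iteratedIntegral_eq, Pi.smul_apply, smul_eq_mul, mul_left_comm _ c,
    intervalIntegral.integral_const_mul]

variable [MeasurableSpace Ω] [BorelSpace Ω] {μ : Measure Ω} [IsProbabilityMeasure μ] {κ : ℝ≥0}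

lemma integrable_iteratedIntegral (φ : Flow ℝ Ω) (v w : HolderSpace κ μ) (t : ℝ) :
    Integrable (fun y => iteratedIntegral φ v.toFun w.toFun t y) μ :=
  integrable_of_measurable_of_bounded (measurable_iteratedIntegral v.mem.1 w.mem.1 t)
    (abs_iteratedIntegral_le φ v.abs_toFun_le w.abs_toFun_le t)

lemma norm_toL1_iteratedIntegral (φ : Flow ℝ Ω) (v w : HolderSpace κ μ) (t : ℝ) :
    ‖(integrable_iteratedIntegral φ v w t).toL1 _‖ =
      ∫ y, |iteratedIntegral φ v.toFun w.toFun t y| ∂μ := by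
  rw [L1.norm_eq_integral_norm]
  refine integral_congr_ae ?_
  filter_upwards [(integrable_iteratedIntegral φ v w t).coeFn_toL1] with y hy
  rw [hy, Real.norm_eq_abs]

/-- The bounded bilinear map `(v, w) ↦ ∫₀ᵗ ∫₀ˢ v ∘ φ_r w ∘ φ_s dr ds` with values in `L¹(μ)`. -/
def iteratedL1 (κ : ℝ≥0) (μ : Measure Ω) [IsProbabilityMeasure μ] (φ : Flow ℝ Ω) (t : ℝ) :
    HolderSpace κ μ →L[ℝ] HolderSpace κ μ →L[ℝ] (Ω →₁[μ] ℝ) :=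
  LinearMap.mkContinuous₂
    (LinearMap.mk₂ ℝ (fun v w => (integrable_iteratedIntegral φ v w t).toL1 _)
      (fun v v' w => by
        rw [← Integrable.toL1_add, Integrable.toL1_eq_toL1_iff]
        exact Eventually.of_forall fun y =>
          iteratedIntegral_add_left v.mem.1 v'.mem.1 w.mem.1 t y)
      (fun c v w => by
        rw [← Integrable.toL1_smul, Integrable.toL1_eq_toL1_iff]
        exact Eventually.of_forall fun y => iteratedIntegral_smul_left c _ _ t y)
      (fun v w w' => by
        rw [← Integrable.toL1_add, Integrable.toL1_eq_toL1_iff]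
        exact Eventually.of_forall fun y =>
          iteratedIntegral_add_right v.mem.1 w.mem.1 w'.mem.1 t y)
      (fun c v w => by
        rw [← Integrable.toL1_smul, Integrable.toL1_eq_toL1_iff]
        exact Eventually.of_forall fun y => iteratedIntegral_smul_right c _ _ t y))
    -- This crude bound only gives continuity at each fixed $t$; uniformity in $n$ after rescaling
    -- comes from Banach–Steinhaus.
    (|t| ^ 2) (fun v w => by
      rw [LinearMap.mk₂_apply, norm_toL1_iteratedIntegral]
      have h := norm_integral_le_of_norm_le_const (μ := μ)
        (f := fun y => |iteratedIntegral φ v.toFun w.toFun t y|) (C := ‖v‖ * ‖w‖ * |t| ^ 2)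
        (Eventually.of_forall fun y => by
          rw [norm_abs_eq_norm]
          exact abs_iteratedIntegral_le φ v.abs_toFun_le w.abs_toFun_le t y)
      rw [Real.norm_of_nonneg (integral_nonneg fun y => abs_nonneg _)] at h
      simp only [probReal_univ, mul_one] at h
      linarith)

lemma norm_iteratedL1_apply (φ : Flow ℝ Ω) (v w : HolderSpace κ μ) (t : ℝ) :
    ‖iteratedL1 κ μ φ t v w‖ = ∫ y, |iteratedIntegral φ v.toFun w.toFun t y| ∂μ :=
  norm_toL1_iteratedIntegral φ v w t

/-- The processes `𝕎_{v,n}(1)` are bounded in `L¹(μ)`, uniformly in `n`, by a multiple of the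
product of the Hölder norms. -/
lemma exists_integral_abs_scaledWW_le (hκ : 0 < κ) (hmom : MomentBounds φ κ μ) :
    ∃ C : ℝ, 0 ≤ C ∧ ∀ (v w : HolderZero κ μ) (n : ℕ),
      ∫ y, |(n : ℝ)⁻¹ * iteratedIntegral φ v w n y| ∂μ ≤
        C * holderNorm κ (v : Ω → ℝ) * holderNorm κ (w : Ω → ℝ) := by
  have := HolderSpace.completeSpace (μ := μ) hκ
  have hnorm : ∀ (n : ℕ) (v w : HolderSpace κ μ), ‖((n : ℝ)⁻¹ • iteratedL1 κ μ φ n) v w‖ =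
      ∫ y, |(n : ℝ)⁻¹ * iteratedIntegral φ v.toFun w.toFun n y| ∂μ := fun n v w => by
    simp only [smul_apply, norm_smul, norm_iteratedL1_apply, abs_mul]
    rw [integral_const_mul, Real.norm_eq_abs]
  obtain ⟨C, hC⟩ := exists_bound_of_pointwise_bound
    (fun n : ℕ => (n : ℝ)⁻¹ • iteratedL1 κ μ φ n) fun v w => by
      obtain ⟨K, hK0, hK⟩ := hmom.exists_bound (show HolderZero κ μ from v)
        (show HolderZero κ μ from w)
      -- From $x\le1+x^3$ and the third moment bound. The constant may depend on `v` and `w`, since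
      -- only pointwise boundedness is needed here.
      refine ⟨1 + K ^ 3, fun n => ?_⟩
      rw [hnorm]
      rcases n.eq_zero_or_pos with rfl | hn
      · simp; positivity
      have hn' : (0 : ℝ) < n := by exact_mod_cast hn
      have hm := measurable_iteratedIntegral (φ := φ) v.mem.1 w.mem.1 n
      have i3 : Integrable (fun y => |iteratedIntegral φ v.toFun w.toFun n y| ^ 3) μ :=
        integrable_of_measurable_of_bounded (C := (‖v‖ * ‖w‖ * |(n : ℝ)| ^ 2) ^ 3)
          (hm.norm.pow_const 3) fun y => by
            rw [abs_pow, abs_abs]; gcongr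
            exact abs_iteratedIntegral_le φ v.abs_toFun_le w.abs_toFun_le _ _
      calc _ ≤ ∫ y, (1 + (n : ℝ)⁻¹ ^ 3 * |iteratedIntegral φ v.toFun w.toFun n y| ^ 3) ∂μ := by
            refine integral_mono_of_nonneg (Eventually.of_forall fun y => abs_nonneg _)
              ((integrable_const _).add (i3.const_mul _)) (Eventually.of_forall fun y => ?_)
            have e : (n : ℝ)⁻¹ ^ 3 * |iteratedIntegral φ v.toFun w.toFun n y| ^ 3 =
                |(n : ℝ)⁻¹ * iteratedIntegral φ v.toFun w.toFun n y| ^ 3 := by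
              rw [abs_mul, mul_pow, abs_of_nonneg (by positivity : 0 ≤ (n : ℝ)⁻¹)]
            simp only [e]
            have h0 := abs_nonneg ((n : ℝ)⁻¹ * iteratedIntegral φ v.toFun w.toFun n y)
            generalize |(n : ℝ)⁻¹ * iteratedIntegral φ v.toFun w.toFun n y| = x at h0
            rcases le_total x 1 with h | h
            · have : 0 ≤ x ^ 3 := by positivity
              linarith
            · have := le_self_pow₀ h (by norm_num : 3 ≠ 0)
              linarith
        _ = 1 + (n : ℝ)⁻¹ ^ 3 * ∫ y, |iteratedIntegral φ v.toFun w.toFun n y| ^ 3 ∂μ := by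
            rw [integral_add (integrable_const _) (i3.const_mul _), integral_const_mul]
            simp
        _ ≤ 1 + (n : ℝ)⁻¹ ^ 3 * (K * n) ^ 3 := by
            gcongr
            exact (hK n hn'.le).2
        _ = 1 + K ^ 3 := by field_simp
  refine ⟨|C|, abs_nonneg C, fun v w n => ?_⟩
  have h : ∫ y, |(n : ℝ)⁻¹ * iteratedIntegral φ v w n y| ∂μ ≤
      C * holderNorm κ (v : Ω → ℝ) * holderNorm κ (w : Ω → ℝ) :=
    (hnorm n v w).symm.trans_le (hC n v w)
  refine h.trans ?_
  have h1 := holderNorm_nonneg (κ := κ) (v : Ω → ℝ)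
  have h2 := holderNorm_nonneg (κ := κ) (w : Ω → ℝ)
  exact mul_le_mul_of_nonneg_right (mul_le_mul_of_nonneg_right (le_abs_self C) h1) h2

variable {𝔅 : HolderZero κ μ →ₗ[ℝ] HolderZero κ μ →ₗ[ℝ] ℝ}

/-- Fatou's lemma along convergence of finite-dimensional distributions. -/
lemma IsLimitPair.integral_abs_snd_le {m : ℕ} {v : Fin m → HolderZero κ μ}
    {Ξ : Type w} [mΞ : MeasurableSpace Ξ] {𝓕 : Filtration ℝ≥0 mΞ} {P : Measure Ξ}
    [IsProbabilityMeasure P] {W : ℝ≥0 → Ξ → Fin m → ℝ} {WW : ℝ≥0 → Ξ → Fin m → Fin m → ℝ}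
    (h : IsLimitPair φ μ 𝔅 v 𝓕 P W WW) (i j : Fin m) {C : ℝ}
    (hC : ∀ n : ℕ, ∫ y, |(n : ℝ)⁻¹ * iteratedIntegral φ (v i) (v j) n y| ∂μ ≤ C) :
    ∫ ω, |WW 1 ω i j| ∂P ≤ C := by
  have hi := (h.integral_snd 1 i j).1
  let τ : ({1} : Finset ℝ≥0) := ⟨1, Finset.mem_singleton_self 1⟩
  -- The absolute value is truncated at $M$ to get a bounded Lipschitz test function; `max 0` makes
  -- it bounded below on all of ℝ without changing it on nonnegative values.
  have key : ∀ M : ℕ, ∫ ω, min |WW 1 ω i j| M ∂P ≤ C := fun M => by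
    let g : (({1} : Finset ℝ≥0) → PairSpace m) → ℝ := fun x => |(x τ).2 i j|
    have hg : Continuous g := by fun_prop
    have h1 := (h.tendsto {1}).continuous_comp hg
    have h2 := tendsto_iff_forall_lipschitz_integral_tendsto.1 h1.tendsto
      (fun x => max 0 (min x M)) ⟨M, fun x y => by
        have hM : (0 : ℝ) ≤ M := M.cast_nonneg
        rw [Real.dist_eq, abs_le]
        have a1 : max 0 (min x (M : ℝ)) ≤ M := max_le hM (min_le_right _ _)
        have a2 : max 0 (min y (M : ℝ)) ≤ M := max_le hM (min_le_right _ _)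
        have b1 : 0 ≤ max 0 (min x (M : ℝ)) := le_max_left _ _
        have b2 : 0 ≤ max 0 (min y (M : ℝ)) := le_max_left _ _
        constructor <;> linarith⟩
      ⟨1, (LipschitzWith.id.min_const _).const_max 0⟩
    have hc : Continuous fun x : ℝ => max 0 (min x (M : ℝ)) := by fun_prop
    simp only [ProbabilityMeasure.coe_mk] at h2
    rw [integral_map h1.aemeasurable_limit hc.aestronglyMeasurable] at h2
    have e : ∫ ω, min |WW 1 ω i j| M ∂P = ∫ ω, max 0 (min |WW 1 ω i j| M) ∂P := by
      congr 1; ext ω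
      exact (max_eq_right (le_min (abs_nonneg _) M.cast_nonneg)).symm
    rw [e]
    refine le_of_tendsto' h2 fun n => ?_
    rw [integral_map (h1.forall_aemeasurable n) hc.aestronglyMeasurable]
    refine le_trans ?_ (hC n)
    obtain ⟨A, hA⟩ := (v i).2.2.1
    obtain ⟨B, hB⟩ := (v j).2.2.1
    have hint : Integrable (fun y => (n : ℝ)⁻¹ * iteratedIntegral φ (v i) (v j) n y) μ :=
      (integrable_of_measurable_of_bounded
        (measurable_iteratedIntegral (v i).2.1 (v j).2.1 _)
        (abs_iteratedIntegral_le φ hA hB n)).const_mul _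
    refine integral_mono_of_nonneg (Eventually.of_forall fun y => le_max_left _ _) hint.abs
      (Eventually.of_forall fun y => ?_)
    have e1 : (g ∘ fun y => ({1} : Finset ℝ≥0).restrict fun t =>
        scaledPair φ (fun i => (v i : Ω → ℝ)) n t y) y =
        |(n : ℝ)⁻¹ * iteratedIntegral φ (v i) (v j) n y| := by
      simp [g, τ, scaledPair, scaledWW]
    simp only [e1]
    exact max_le (abs_nonneg _) (min_le_left _ _)
  have hlim : Tendsto (fun M : ℕ => ∫ ω, min |WW 1 ω i j| M ∂P) atTop
      (𝓝 (∫ ω, |WW 1 ω i j| ∂P)) := by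
    refine tendsto_integral_of_dominated_convergence (fun ω => |WW 1 ω i j|) (fun M => ?_) hi.abs
      (fun M => Eventually.of_forall fun ω => ?_) (Eventually.of_forall fun ω => ?_)
    · exact (hi.abs.inf (integrable_const _)).aestronglyMeasurable
    · rw [Real.norm_of_nonneg (le_min (abs_nonneg _) M.cast_nonneg)]
      exact min_le_left _ _
    · refine tendsto_const_nhds.congr' ?_
      filter_upwards [eventually_ge_atTop ⌈|WW 1 ω i j|⌉₊] with M hM
      exact (min_eq_left ((Nat.le_ceil _).trans (Nat.cast_le.2 hM))).symm
  exact le_of_tendsto' hlim key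

/-- A limit pair for the two-component observable $(v,w)$ represents $\mathfrak B(v,w)$ as the mean
of $\mathbb W^{01}(1)$, to which the uniform $L^1$ bound passes. -/
lemma IteratedCLT.exists_bound (hκ : 0 < κ) (hclt : IteratedCLT.{u, w} φ μ 𝔅)
    (hmom : MomentBounds φ κ μ) : ∃ C : ℝ, ∀ v w : HolderZero κ μ,
      |𝔅 v w| ≤ C * holderNorm κ (v : Ω → ℝ) * holderNorm κ (w : Ω → ℝ) := by
  obtain ⟨C, -, hC⟩ := exists_integral_abs_scaledWW_le hκ hmom
  refine ⟨C, fun v w => ?_⟩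
  obtain ⟨Ξ, mΞ, 𝓕, P, hP, W, WW, h⟩ := hclt 2 ![v, w]
  have h1 := (h.integral_snd 1 0 1).2
  have h2 : 𝔅 v w = ∫ ω, WW 1 ω 0 1 ∂P := by simpa using h1.symm
  rw [h2]
  exact (abs_integral_le_integral_abs).trans (h.integral_abs_snd_le 0 1 (hC v w))

end Boundedness

end FastFlow

end

theorem mainTheorem7 {Ω : Type u} [MetricSpace Ω] [SecondCountableTopology Ω]
    [MeasurableSpace Ω] [BorelSpace Ω]
    (φ : Flow ℝ Ω) (μ : Measure Ω) [IsProbabilityMeasure μ] (hμ : FastFlow.IsErgodicFlow φ μ)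
    (κ : ℝ≥0) (hκ0 : 0 < κ) (hκ1 : κ < 1)
    (𝔅 : FastFlow.HolderZero κ μ →ₗ[ℝ] FastFlow.HolderZero κ μ →ₗ[ℝ] ℝ)
    (hclt : FastFlow.IteratedCLT.{u, w} φ μ 𝔅)
    (hmom : FastFlow.MomentBounds φ κ μ) :
    -- (a) and (d), for every realization of the limit pair
    (∀ (m : ℕ) (v : Fin m → FastFlow.HolderZero κ μ) (Ξ : Type w) (mΞ : MeasurableSpace Ξ)
      (𝓕 : Filtration ℝ≥0 mΞ) (P : Measure Ξ) (_ : IsProbabilityMeasure P)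
      (W : ℝ≥0 → Ξ → Fin m → ℝ) (WW : ℝ≥0 → Ξ → Fin m → Fin m → ℝ),
      FastFlow.IsLimitPair φ μ 𝔅 v 𝓕 P W WW →
        (∀ i j, Integrable (fun ω => W 1 ω i * W 1 ω j) P ∧
          ∫ ω, W 1 ω i * W 1 ω j ∂P = 𝔅 (v i) (v j) + 𝔅 (v j) (v i)) ∧
        FastFlow.TendstoWeaklySup (FastFlow.scaledPair φ fun i => (v i : Ω → ℝ)) μ
          (fun t ω => (W t ω, WW t ω)) P) ∧
    -- (b)
    (∀ v, 0 ≤ 𝔅 v v) ∧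
    -- (c)
    (∃ C : ℝ, ∀ v w, |𝔅 v w| ≤
      C * FastFlow.holderNorm κ (v : Ω → ℝ) * FastFlow.holderNorm κ (w : Ω → ℝ)) := by
  exact ⟨fun m v Ξ mΞ 𝓕 P hP W WW h => ⟨h.covariance, h.tendstoWeaklySup hμ hmom⟩,
    hclt.apply_self_nonneg, hclt.exists_bound hκ0 hmom⟩
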